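/- **Setting.** Let $n_1,n_2,n_3\ge 1$. Tensors are real third-order arrays; $\|\cdot\|_F$ is the Frobenius norm; a tube is a vector of length $n_3$. Let $\mathcal L$ be the (unnormalised) discrete Fourier transform applied to all tubes along the third dimension. The product of tubes is $\mathbf a\bullet\mathbf b=\mathcal L^{-1}(\mathcal L(\mathbf a)\circ\mathcal L(\mathbf b))$ ($\circ$ the entrywise product), and $(\mathcal A\bullet\mathcal B)(i,j,:)=\sum_s\mathcal A(i,s,:)\bullet\mathcal B(s,j,:)$. The transpose $\mathcal A^\dagger$ is the tensor whose $k$-th frontal slice in the transform domain is $(\mathcal L(\mathcal A)^{(k)})^H$; $\mathbf e=\mathcal L^{-1}(\mathbf 1)$; the identity tensor $\mathcal I$ has the tubes $\mathbf e$ on its diagonal and zeros elsewhere. Let $\mathcal U\in\mathbb R^{n_1\times n_2\times n_3}$ satisfy $\mathcal U^\dagger\bullet\mathcal U=\mathcal I$, let $\mathcal S$ be the $n_2$-dimensional tensor-column subspace spanned by its columns, let $\mathcal P=\mathcal U\bullet(\mathcal U^\dagger\bullet\mathcal U)^{-1}\bullet\mathcal U^\dagger$, and let $$\mu(\mathcal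 S)=\frac{n_1}{n_2}\max_{j}\|\mathcal P\bullet\mathcal E_j\|_F^2,$$ where $\mathcal E_j\in\mathbb R^{n_1\times1\times n_3}$ has the tube $\mathbf e$ in position $j$ and zeros elsewhere. Let $\mathbf U=\mathrm{bcirc}(\mathcal U)\in\mathbb R^{n_1n_3\times n_2n_3}$ be the block circulant matrix whose block in block position $(k,l)$ is the frontal slice of $\mathcal U$ with index $k-l$ modulo $n_3$ (slices indexed $0,\dots,n_3-1$), and let $\mathbf S\subset\mathbb R^{n_1n_3}$ be the span of its columns. Let $\mathcal T\in\mathbb R^{n_1\times1\times n_3}$, let $\mathbf t=\mathrm{unfold}(\mathcal T)\in\mathbb R^{n_1n_3}$ be the vector obtained by stacking the frontal slices of $\mathcal T$, and write $\mathbf t=\mathbf x+\mathbf y$ with $\mathbf x\in\mathbf S$ and $\mathbf y\in\mathbf S^\perp$. Let $\Omega=(\Omega(1),\dots,\Omega(m))$ be $m$ positions drawn independently and uniformly, with replacement, from the $n_1n_3$ positions. Let $\mathbf t_\Omega\in\mathbb R^m$ and $\mathbf U_\Omega\in\mathbb R^{m\times n_2n_3}$ consist of the entries of $\mathbf t$ and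 the rows of $\mathbf U$ at the positions $\Omega(1),\dots,\Omega(m)$ (repeated as often as they are drawn), and let $\mathbf P_\Omega=\mathbf U_\Omega(\mathbf U_\Omega^H\mathbf U_\Omega)^{-1}\mathbf U_\Omega^H$. **Statement.** Let $\delta>0$ and $m\ge\frac83 n_2n_3\,\mu(\mathcal S)\log\left(\frac{2n_2n_3}{\delta}\right)$. Then, with probability at least $1-4\delta$, the matrix $\mathbf U_\Omega^H\mathbf U_\Omega$ is invertible and $$\frac{m(1-\alpha)-n_2n_3\,\mu(\mathcal S)\frac{\beta}{1-\gamma}}{n_1n_3}\,\|\mathcal T-\mathcal P\bullet\mathcal T\|_F^2\;\le\;\|\mathbf t_\Omega-\mathbf P_\Omega\mathbf t_\Omega\|_2^2\;\le\;(1+\alpha)\frac{m}{n_1n_3}\,\|\mathcal T-\mathcal P\bullet\mathcal T\|_F^2,$$ where $$\alpha=\sqrt{\frac{2(n_1n_3\|\mathbf y\|_\infty^2-\|\mathbf y\|_2^2)}{m\|\mathbf y\|_2^2}\log\frac1\delta}+\frac{2(n_1n_3\|\mathbf y\|_\infty^2-\|\mathbf y\|_2^2)}{3m\|\mathbf y\|_2^2}\log\frac1\delta,$$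 $$\beta=\Bigl(1+2\sqrt{\log\tfrac1\delta}\Bigr)^2,\qquad \gamma=\sqrt{\frac{8n_2n_3\,\mu(\mathcal S)}{3m}\log\left(\frac{2n_2n_3}{\delta}\right)}.$$ (Read $\alpha$ as $0$ when $\mathbf y=0$. The lower bound is asserted when $\gamma<1$; in the borderline case $\gamma=1$ its left-hand side has a zero denominator and only the invertibility and the upper bound are asserted. For $\delta\ge\frac14$ there is nothing to prove.) -/

import Mathlib

namespace TensorMSD

noncomputable section

open Matrix

/-- Real third-order tensors of size `n₁ × n₂ × n₃`. The third index runs over `ZMod n₃`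
(the frontal slices are numbered `0, …, n₃ - 1`), so that cyclic shifts are subtractions. -/
abbrev Tensor (n₁ n₂ n₃ : ℕ) : Type := Fin n₁ → Fin n₂ → ZMod n₃ → ℝ

section Tubes

variable {n : ℕ} [NeZero n]

/-- The transform `L` of a real tube: its (unnormalised) discrete Fourier transform. -/
def tubeDFT (a : ZMod n → ℝ) : ZMod n → ℂ :=
  ZMod.dft (fun k => (a k : ℂ))

/-- The inverse transform `L⁻¹`, with values in real tubes. It is only applied to conjugate
symmetric spectra, for which the inverse DFT is real; see `coe_tubeIDFT`. -/
def tubeIDFT (b : ZMod n → ℂ) : ZMod n → ℝ :=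
  fun k => (ZMod.dft.symm b k).re

/-- Tube multiplication `a • b = L⁻¹(L(a) ∘ L(b))`, with `∘` the entrywise product. -/
def tubeMul (a b : ZMod n → ℝ) : ZMod n → ℝ :=
  tubeIDFT (fun k => tubeDFT a k * tubeDFT b k)

/-- The multiplicative unit `e = L⁻¹(1)` for the multiplication of tubes. -/
def tubeOne : ZMod n → ℝ :=
  tubeIDFT (fun _ => 1)

/-- Entrywise conjugation in the transform domain. -/
def tubeConj (a : ZMod n → ℝ) : ZMod n → ℝ :=
  tubeIDFT (fun k => star (tubeDFT a k))

theorem tubeDFT_neg (a : ZMod n → ℝ) (k : ZMod n) :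
    tubeDFT a (-k) = star (tubeDFT a k) := by
  simp only [tubeDFT, ZMod.dft_apply, smul_eq_mul, star_sum, star_mul']
  refine Finset.sum_congr rfl fun j _ => ?_
  have h : star (ZMod.stdAddChar (N := n) (-(j * k))) = ZMod.stdAddChar (N := n) (j * k) := by
    have := AddChar.map_neg_eq_conj (ZMod.stdAddChar (N := n)) (j * k)
    rw [this]; simp
  rw [h]
  simp

/-- On conjugate symmetric spectra, `tubeIDFT` is exactly the inverse DFT: no imaginary part
is discarded. -/
theorem coe_tubeIDFT (b : ZMod n → ℂ) (hb : ∀ k, b (-k) = star (b k)) (k : ZMod n) :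
    ((tubeIDFT b k : ℝ) : ℂ) = ZMod.dft.symm b k := by
  have h : star (ZMod.dft.symm b k) = ZMod.dft.symm b k := by
    rw [ZMod.invDFT_apply]
    simp only [smul_eq_mul, star_mul', star_sum]
    congr 1
    · simp
    · rw [← Equiv.sum_comp (Equiv.neg (ZMod n))]
      refine Finset.sum_congr rfl fun j _ => ?_
      have h2 := AddChar.map_neg_eq_conj (ZMod.stdAddChar (N := n)) (j * k)
      simp only [Equiv.neg_apply, hb, star_star, neg_mul, h2]
      simp
  exact Complex.conj_eq_iff_re.mp h

theorem coe_tubeMul (a b : ZMod n → ℝ) (k : ZMod n) :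
    ((tubeMul a b k : ℝ) : ℂ) = ZMod.dft.symm (fun l => tubeDFT a l * tubeDFT b l) k :=
  coe_tubeIDFT _ (fun l => by simp [tubeDFT_neg]) k

theorem coe_tubeOne (k : ZMod n) :
    ((tubeOne k : ℝ) : ℂ) = ZMod.dft.symm (fun _ : ZMod n => (1 : ℂ)) k :=
  coe_tubeIDFT _ (fun _ => by simp) k

theorem coe_tubeConj (a : ZMod n → ℝ) (k : ZMod n) :
    ((tubeConj a k : ℝ) : ℂ) = ZMod.dft.symm (fun l => star (tubeDFT a l)) k :=
  coe_tubeIDFT _ (fun l => by simp [tubeDFT_neg]) k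

end Tubes

section Tensors

variable {n₁ n₂ n₃ n₄ : ℕ} [NeZero n₃]

/-- The `L`-product of tensors: matrix multiplication with tubes as entries. -/
def lprod (A : Tensor n₁ n₂ n₃) (B : Tensor n₂ n₄ n₃) : Tensor n₁ n₄ n₃ :=
  fun i j => ∑ s, tubeMul (A i s) (B s j)

/-- The tensor transpose: each frontal slice of `L(A†)` is the conjugate transpose of the
corresponding frontal slice of `L(A)`. -/
def ltranspose (A : Tensor n₁ n₂ n₃) : Tensor n₂ n₁ n₃ :=
  fun i j => tubeConj (A j i)

/-- The identity tensor: tubes `e` on the diagonal and zero tubes elsewhere. -/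
def lone (n n₃ : ℕ) [NeZero n₃] : Tensor n n n₃ :=
  fun i j => if i = j then tubeOne else 0

open Classical in
/-- The inverse of a square tensor for the `L`-product (and `0` if there is none). -/
def linv (A : Tensor n₂ n₂ n₃) : Tensor n₂ n₂ n₃ :=
  if h : ∃ B : Tensor n₂ n₂ n₃, lprod A B = lone n₂ n₃ ∧ lprod B A = lone n₂ n₃ then
    h.choose
  else 0

/-- The Frobenius norm of a tensor. -/
def frobNorm (A : Tensor n₁ n₂ n₃) : ℝ :=
  √(∑ i, ∑ j, ∑ k, A i j k ^ 2)

/-- The orthogonal projection `P = U • (U† • U)⁻¹ • U†` onto the tensor-column subspace spanned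
by the columns of `U`. -/
def tensorProj (U : Tensor n₁ n₂ n₃) : Tensor n₁ n₁ n₃ :=
  lprod (lprod U (linv (lprod (ltranspose U) U))) (ltranspose U)

/-- The tensor basis column `E_j`, with tube `e` in position `j` and zeros elsewhere. -/
def lbasis (n₃ : ℕ) [NeZero n₃] (j : Fin n₁) : Tensor n₁ 1 n₃ :=
  fun i _ => if i = j then tubeOne else 0

/-- The coherence `(n₁ / n₂) max_j ‖P • E_j‖_F²` of the `n₂`-dimensional tensor-column subspace
spanned by the columns of `U`. -/
def tensorCoherence (U : Tensor n₁ n₂ n₃) : ℝ :=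
  (n₁ : ℝ) / n₂ * ⨆ j : Fin n₁, frobNorm (lprod (tensorProj U) (lbasis n₃ j)) ^ 2

/-- `unfold` of a tensor column: the frontal slices stacked into one vector. The position
`(k - 1) n₁ + i` of the stacked vector is the index `(i, k)`. -/
def unfold (T : Tensor n₁ 1 n₃) : EuclideanSpace ℝ (Fin n₁ × ZMod n₃) :=
  WithLp.toLp 2 fun p => T p.1 0 p.2

/-- The block circulant matrix of a tensor: its block in block position `(k, l)` is the frontal
slice with number `k - l` modulo `n₃`. -/
def bcirc (A : Tensor n₁ n₂ n₃) : Matrix (Fin n₁ × ZMod n₃) (Fin n₂ × ZMod n₃) ℝ :=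
  Matrix.of fun p q => A p.1 q.1 (p.2 - q.2)

/-- The vector subspace spanned by the columns of the block circulant matrix of `U`. -/
def vecSubspace (U : Tensor n₁ n₂ n₃) : Submodule ℝ (EuclideanSpace ℝ (Fin n₁ × ZMod n₃)) :=
  Submodule.span ℝ (Set.range fun q => WithLp.toLp 2 ((bcirc U).col q))

end Tensors

section Sampling

variable {n₁ n₂ n₃ m : ℕ} [NeZero n₃]

/-- The sampled vector `t_Ω`: the entry of `unfold T` at the `k`-th sampled position, for each of
the `m` samples (a position that is sampled several times is repeated). -/
def sampleVec (T : Tensor n₁ 1 n₃) (ω : Fin m → Fin n₁ × ZMod n₃) : Fin m → ℝ :=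
  fun k => unfold T (ω k)

/-- The sampled matrix `U_Ω`: the rows of `bcirc U` at the sampled positions. -/
def sampleMat (U : Tensor n₁ n₂ n₃) (ω : Fin m → Fin n₁ × ZMod n₃) :
    Matrix (Fin m) (Fin n₂ × ZMod n₃) ℝ :=
  (bcirc U).submatrix ω id

/-- The matrix `P_Ω = U_Ω (U_Ωᴴ U_Ω)⁻¹ U_Ωᴴ`. -/
def sampleProj (U : Tensor n₁ n₂ n₃) (ω : Fin m → Fin n₁ × ZMod n₃) :
    Matrix (Fin m) (Fin m) ℝ :=
  sampleMat U ω * ((sampleMat U ω)ᴴ * sampleMat U ω)⁻¹ * (sampleMat U ω)ᴴ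

/-- The estimator `‖t_Ω - P_Ω t_Ω‖₂²` of the residual energy. -/
def sampleResidual (U : Tensor n₁ n₂ n₃) (T : Tensor n₁ 1 n₃) (ω : Fin m → Fin n₁ × ZMod n₃) : ℝ :=
  ‖WithLp.toLp 2 (sampleVec T ω - sampleProj U ω *ᵥ sampleVec T ω)‖ ^ 2

end Sampling

end

end TensorMSD

open TensorMSD

/-! The DFT turns cyclic convolution into the entrywise product, so `bcirc` is an injective map that
respects products, transposes and identities. Hence `bcirc U` has orthonormal columns, the tensor
projection acts on unfoldings as the orthogonal projection onto the column space, and the residual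
energy is `‖y‖²`. With `ρ` the largest squared row norm of `bcirc U` and `N = n₁ n₃`, the quantity
`n₂ n₃ μ` equals `ρ N`.

On a sample, `t_Ω = U_Ω a + y_Ω`. The component in the range of `U_Ω` is projected away, and the
estimator equals `‖y_Ω‖²` minus the energy of the projection of `y_Ω`, which is at most `‖U_Ωᴴ y_Ω‖²
/ λ` when `λ > 0` bounds the spectrum of `U_Ωᴴ U_Ω` from below. Four events, each of probability at
most `δ`, are excluded: a small eigenvalue of the Gram matrix, either tail of `‖y_Ω‖²`, and a large
`‖U_Ωᴴ y_Ω‖`.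

The eigenvalue bound is a matrix Chernoff inequality (`freq_exists_dotProduct_sum_le`). Traces of
`(1 - (θ/(k+1)) Σ u uᵀ)^(k+1)` play the role of the trace exponential; the rank one estimate
`trace_sub_vecMulVec_pow_le` replaces Golden–Thompson, and `k → ∞` at the end. The other three
events follow from one Bernstein inequality for functions of a sum with controlled increments
(`freq_le_of_bernstein`), applied to the identity on `ℝ` and to a norm.

Two points make the stated constants suffice. The lower tail of `‖y_Ω‖²` costs slightly more than
`α`, and the slack in `β` pays for it. The vector inequality needs enough samples relative to the
spikes of `y`; this holds whenever the claimed lower bound is positive, and otherwise that bound is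
trivial. -/

open scoped BigOperators
open Matrix

/-! ### Probability under uniform sampling as relative frequency -/

/-- The relative frequency of a set in a finite type. -/
noncomputable def freq {Ω : Type*} [Fintype Ω] (S : Set Ω) : ℝ :=
  𝔼 ω, S.indicator (fun _ => (1 : ℝ)) ω

section Freq

variable {Ω : Type*} [Fintype Ω]

theorem freq_mono {S T : Set Ω} (h : S ⊆ T) : freq S ≤ freq T :=
  Finset.expect_le_expect fun ω _ =>
    Set.indicator_le_indicator_of_subset h (fun _ => zero_le_one) ω

theorem freq_union_le (S T : Set Ω) : freq (S ∪ T) ≤ freq S + freq T := by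
  unfold freq
  rw [← Finset.expect_add_distrib]
  refine Finset.expect_le_expect fun ω _ => ?_
  by_cases hS : ω ∈ S <;> by_cases hT : ω ∈ T <;> simp [hS, hT]

theorem freq_add_freq_compl [Nonempty Ω] (S : Set Ω) : freq S + freq Sᶜ = 1 := by
  unfold freq
  rw [← Finset.expect_add_distrib, ← Fintype.expect_one (ι := Ω) (M := ℝ)]
  refine Finset.expect_congr rfl fun ω _ => ?_
  by_cases hS : ω ∈ S <;> simp [hS]

theorem freq_empty : freq (∅ : Set Ω) = 0 := by
  simp [freq]

theorem freq_mul_le_expect (f : Ω → ℝ) (hf : ∀ ω, 0 ≤ f ω) (a : ℝ) :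
    freq {ω | a ≤ f ω} * a ≤ 𝔼 ω, f ω := by
  unfold freq
  rw [Finset.expect_mul]
  refine Finset.expect_le_expect fun ω _ => ?_
  by_cases h : a ≤ f ω
  · simp [h]
  · simpa [h] using hf ω

theorem toOuterMeasure_uniformOfFintype_eq_freq [Nonempty Ω] (S : Set Ω) :
    (PMF.uniformOfFintype Ω).toOuterMeasure S = ENNReal.ofReal (freq S) := by
  classical
  rw [PMF.toOuterMeasure_uniformOfFintype_apply, freq, Fintype.expect_eq_sum_div_card,
    ENNReal.ofReal_div_of_pos (by exact_mod_cast Fintype.card_pos)]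
  congr 1
  · rw [Finset.sum_indicator_eq_sum_filter]
    simp [Fintype.card_subtype]
  · simp

end Freq

/-! ### Exponential moments and Bernstein's inequality -/

theorem one_sub_div_three_mul_exp_le (x : ℝ) :
    (1 - x / 3) * (Real.exp x - 1 - x) ≤ x ^ 2 / 2 := by
  set k : ℝ → ℝ := fun x => x ^ 2 / 2 - (1 - x / 3) * (Real.exp x - 1 - x) with hk
  set k' : ℝ → ℝ := fun x => x + 1 / 3 * (Real.exp x - 1 - x) - (1 - x / 3) * (Real.exp x - 1)
    with hk'
  have hd (x : ℝ) : HasDerivAt k (k' x) x := by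
    have h1 : HasDerivAt (fun x : ℝ => x ^ 2 / 2) (2 * x / 2) x := by
      simpa using (hasDerivAt_pow 2 x).div_const 2
    have h2 : HasDerivAt (fun x : ℝ => 1 - x / 3) (-(1 / 3)) x := by
      simpa using ((hasDerivAt_id x).div_const 3).const_sub 1
    have h3 : HasDerivAt (fun x : ℝ => Real.exp x - 1 - x) (Real.exp x - 1) x := by
      exact ((Real.hasDerivAt_exp x).sub_const 1).sub (hasDerivAt_id' x)
    convert! h1.sub (h2.mul h3) using 1
    simp only [hk']; ring
  have hd' (x : ℝ) : HasDerivAt k' ((1 + (x - 1) * Real.exp x) / 3) x := by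
    have h2 : HasDerivAt (fun x : ℝ => 1 - x / 3) (-(1 / 3)) x := by
      simpa using ((hasDerivAt_id x).div_const 3).const_sub 1
    have h4 : HasDerivAt (fun x : ℝ => Real.exp x - 1) (Real.exp x) x :=
      (Real.hasDerivAt_exp x).sub_const 1
    have h3 : HasDerivAt (fun x : ℝ => Real.exp x - 1 - x) (Real.exp x - 1) x := by
      exact h4.sub (hasDerivAt_id' x)
    convert! ((hasDerivAt_id x).add (h3.const_mul (1 / 3))).sub (h2.mul h4) using 1
    ring
  -- Convexity of `k` amounts to `(1 - x) eˣ ≤ 1`, which is `1 - x ≤ e⁻ˣ`. Since `k` and `k'` vanish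
  -- at `0`, the minimum of `k` is `0`.
  have hmono : Monotone k' := by
    refine monotone_of_deriv_nonneg (fun x => (hd' x).differentiableAt) fun x => ?_
    rw [(hd' x).deriv]
    have h := Real.add_one_le_exp (-x)
    have h2 := mul_le_mul_of_nonneg_right h (Real.exp_pos x).le
    rw [← Real.exp_add, neg_add_cancel, Real.exp_zero] at h2
    nlinarith
  have h0 : k' 0 = 0 := by simp [hk']
  have hk0 : k 0 = 0 := by simp [hk]
  suffices 0 ≤ k x by simpa [hk] using this
  have hc : Continuous k := continuous_iff_continuousAt.2 fun x => (hd x).continuousAt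
  rcases le_total 0 x with hx | hx
  · have : MonotoneOn k (Set.Ici 0) := by
      refine monotoneOn_of_deriv_nonneg (convex_Ici 0) hc.continuousOn
        (fun x _ => (hd x).differentiableAt.differentiableWithinAt) fun x hx => ?_
      rw [(hd x).deriv, ← h0]
      exact hmono (interior_subset hx)
    simpa [hk0] using this (Set.mem_Ici.2 le_rfl) hx hx
  · have : AntitoneOn k (Set.Iic 0) := by
      refine antitoneOn_of_deriv_nonpos (convex_Iic 0) hc.continuousOn
        (fun x _ => (hd x).differentiableAt.differentiableWithinAt) fun x hx => ?_
      rw [(hd x).deriv, ← h0]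
      exact hmono (by simpa using (interior_subset hx : x ∈ Set.Iic 0))
    simpa [hk0] using this hx (Set.mem_Iic.2 le_rfl) hx

theorem exp_le_one_add_add_sq_div {x b : ℝ} (hb : b < 3) (hx : x ≤ b) :
    Real.exp x ≤ 1 + x + x ^ 2 / (2 * (1 - b / 3)) := by
  have h1 := one_sub_div_three_mul_exp_le x
  have h2 := Real.add_one_le_exp x
  have hp : 0 < 1 - b / 3 := by linarith
  have h3 : (Real.exp x - 1 - x) ≤ x ^ 2 / (2 * (1 - b / 3)) := by
    rw [le_div_iff₀ (by positivity)]
    nlinarith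
  linarith

theorem expect_fin_succ {X : Type*} [Fintype X] {m : ℕ} (f : (Fin (m + 1) → X) → ℝ) :
    𝔼 ω, f ω = 𝔼 x, 𝔼 ω : Fin m → X, f (Fin.cons x ω) := by
  rw [← Finset.expect_product', Finset.univ_product_univ]
  exact (Fintype.expect_equiv (Fin.consEquiv fun _ => X) _ _ fun _ => rfl).symm

section Bernstein

variable {X E : Type*} [Fintype X] [Nonempty X] [AddCommMonoid E] (z : X → E)

/-- Exponential moment bound for a function of a sum of independent uniform samples, in terms of
one-sided and quadratic bounds on the increments of that function. -/
theorem expect_exp_le (c : X → ℝ) {R v l : ℝ} (hv : 𝔼 x, c x ^ 2 ≤ v)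
    (hl : 0 ≤ l) (hlR : l * R < 3) (m : ℕ) (h : E → ℝ) (hR : ∀ e x, h (e + z x) - h e ≤ R)
    (hc : ∀ e x, |h (e + z x) - h e| ≤ c x) :
    𝔼 ω : Fin m → X, Real.exp (l * h (∑ i, z (ω i))) ≤
      Real.exp (l * (𝔼 ω : Fin m → X, h (∑ i, z (ω i))) +
        m * (v * (l ^ 2 / (2 * (1 - l * R / 3))))) := by
  induction m generalizing h with
  | zero => simp
  | succ m ih =>
    -- Averaging out one sample turns `h` into `g`, whose increments obey the same two bounds. The
    -- induction hypothesis is applied to `g`, and the averaged sample contributes a single factor.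
    set g : E → ℝ := fun e => 𝔼 x, h (e + z x) with hg
    have hkey (e : E) : 𝔼 x, Real.exp (l * h (e + z x)) ≤
        Real.exp (l * g e + v * (l ^ 2 / (2 * (1 - l * R / 3)))) := by
      have hq : 0 ≤ l ^ 2 / (2 * (1 - l * R / 3)) := by
        have : 0 < 1 - l * R / 3 := by linarith
        positivity
      have h1 (x : X) : Real.exp (l * (h (e + z x) - h e)) ≤
          1 + l * (h (e + z x) - h e) + c x ^ 2 * (l ^ 2 / (2 * (1 - l * R / 3))) := by
        refine (exp_le_one_add_add_sq_div hlR (mul_le_mul_of_nonneg_left (hR e x) hl)).trans ?_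
        gcongr
        rw [mul_pow, mul_comm (l ^ 2), mul_div_assoc]
        exact mul_le_mul_of_nonneg_right (sq_le_sq' (by linarith [(abs_le.1 (hc e x)).1])
          (abs_le.1 (hc e x)).2) hq
      calc 𝔼 x, Real.exp (l * h (e + z x))
          = Real.exp (l * h e) * 𝔼 x, Real.exp (l * (h (e + z x) - h e)) := by
            rw [Finset.mul_expect]
            refine Finset.expect_congr rfl fun x _ => ?_
            rw [← Real.exp_add]; ring_nf
        _ ≤ Real.exp (l * h e) * (l * (g e - h e) + v * (l ^ 2 / (2 * (1 - l * R / 3))) + 1) := by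
            gcongr
            refine (Finset.expect_le_expect fun x _ => h1 x).trans ?_
            rw [Finset.expect_add_distrib, Finset.expect_add_distrib, ← Finset.mul_expect,
              Finset.expect_sub_distrib, Fintype.expect_const, Fintype.expect_const,
              ← Finset.expect_mul]
            have := mul_le_mul_of_nonneg_right hv hq
            linarith
        _ ≤ Real.exp (l * h e) * Real.exp (l * (g e - h e) + v * (l ^ 2 / (2 * (1 - l * R / 3)))) := by
            gcongr
            exact Real.add_one_le_exp _
        _ = _ := by rw [← Real.exp_add]; ring_nf
    have hsum (F : E → ℝ) : 𝔼 ω : Fin (m + 1) → X, F (∑ i, z (ω i)) =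
        𝔼 ω : Fin m → X, 𝔼 x, F ((∑ i, z (ω i)) + z x) := by
      rw [expect_fin_succ, Finset.expect_comm]
      simp [Fin.sum_univ_succ, add_comm]
    have hgdiff (e : E) (x : X) : g (e + z x) - g e = 𝔼 x', (h ((e + z x') + z x) - h (e + z x')) := by
      rw [Finset.expect_sub_distrib]
      simp only [hg, add_right_comm]
    have ih' := ih g (fun e x => by
        rw [hgdiff]
        exact Finset.expect_le Finset.univ_nonempty fun x' _ => hR _ _)
      (fun e x => by
        rw [hgdiff]
        refine (Finset.abs_expect_le _ _).trans ?_
        exact Finset.expect_le Finset.univ_nonempty fun x' _ => hc _ _)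
    rw [hsum (fun e => Real.exp (l * h e)), hsum h]
    refine (Finset.expect_le_expect fun ω _ => hkey _).trans ?_
    simp_rw [Real.exp_add (l * g _)]
    rw [← Finset.expect_mul]
    refine (mul_le_mul_of_nonneg_right ih' (Real.exp_pos _).le).trans ?_
    rw [← Real.exp_add]
    apply le_of_eq
    congr 1
    push_cast
    ring

/-- Bernstein's inequality for functions of a sum of independent uniform samples. -/
theorem freq_le_of_bernstein (c : X → ℝ) {R v t L : ℝ} (hv : 𝔼 x, c x ^ 2 ≤ v) (hR0 : 0 < R)
    (ht : 0 < t) (m : ℕ) (h : E → ℝ) (hR : ∀ e x, h (e + z x) - h e ≤ R)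
    (hc : ∀ e x, |h (e + z x) - h e| ≤ c x)
    (hL : 2 * L * (m * v + R * t / 3) ≤ t ^ 2) :
    freq {ω : Fin m → X | (𝔼 ω : Fin m → X, h (∑ i, z (ω i))) + t ≤ h (∑ i, z (ω i))} ≤
      Real.exp (-L) := by
  have hv0 : 0 ≤ v := (Finset.expect_nonneg fun x _ => sq_nonneg (c x)).trans hv
  set μ : ℝ := 𝔼 ω : Fin m → X, h (∑ i, z (ω i))
  have hden : 0 < m * v + R * t / 3 := by positivity
  -- With this exponent `1 - l R / 3 = m v / (m v + R t / 3)`, so the quadratic term is exactly `l t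
  -- / 2`, while `hL` says `2 L ≤ l t`.
  set l : ℝ := t / (m * v + R * t / 3) with hl
  have hl0 : 0 < l := by positivity
  have hmv : 0 ≤ m * v := by positivity
  have htail (l : ℝ) (hl0 : 0 < l) (hlR : l * R < 3) :
      freq {ω : Fin m → X | μ + t ≤ h (∑ i, z (ω i))} ≤
        Real.exp (m * v * (l ^ 2 / (2 * (1 - l * R / 3))) - l * t) := by
    have h1 := expect_exp_le z c hv hl0.le hlR m h hR hc
    have h2 := freq_mul_le_expect (fun ω : Fin m → X => Real.exp (l * h (∑ i, z (ω i))))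
      (fun ω => (Real.exp_pos _).le) (Real.exp (l * (μ + t)))
    have h3 : {ω : Fin m → X | Real.exp (l * (μ + t)) ≤ Real.exp (l * h (∑ i, z (ω i)))} =
        {ω : Fin m → X | μ + t ≤ h (∑ i, z (ω i))} := by
      ext ω; simp [hl0]
    rw [h3] at h2
    have h4 := h2.trans h1
    rw [← le_div_iff₀ (Real.exp_pos _), ← Real.exp_sub] at h4
    refine h4.trans (le_of_eq ?_)
    congr 1; ring
  rcases hmv.eq_or_lt with hmv0 | hmv0
  -- When `m v = 0` the choice above gives `l R = 3`, just outside the admissible range; half of it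
  -- still suffices because `hL` reduces to `2 L R / 3 ≤ t`.
  · refine (htail (3 / (2 * R)) (by positivity) (by field_simp; norm_num)).trans ?_
    apply Real.exp_le_exp.2
    rw [← hmv0, zero_add] at hL
    rw [← hmv0, zero_mul, zero_sub, neg_le_neg_iff, div_mul_eq_mul_div,
      le_div_iff₀ (by positivity)]
    by_contra hcon
    push Not at hcon
    nlinarith [mul_lt_mul_of_pos_right hcon ht]
  have hlR : l * R < 3 := by
    rw [hl, div_mul_eq_mul_div, div_lt_iff₀ hden]
    nlinarith
  refine (htail l hl0 hlR).trans (Real.exp_le_exp.2 ?_)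
  have h5 : 1 - l * R / 3 = m * v / (m * v + R * t / 3) := by
    rw [hl]; field_simp; ring
  have h6 : m * v * (l ^ 2 / (2 * (1 - l * R / 3))) = l * t / 2 := by
    have h0 := hmv0.ne'
    rw [h5, hl]
    generalize (m : ℝ) * v = w at *
    field_simp
  have h7 : 2 * L ≤ l * t := by
    rw [hl, div_mul_eq_mul_div, le_div_iff₀ hden]
    linarith
  rw [h6]
  linarith

end Bernstein

/-! ### Spectral moments and rank one updates -/

theorem sum_mul_pow_mul_sum_mul_pow_le {ι : Type*} [Fintype ι] (w q : ι → ℝ) (hw : ∀ i, 0 ≤ w i) (hq : ∀ i, 0 ≤ q i)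
    (a b : ℕ) :
    (∑ i, w i * q i ^ a) * (∑ i, w i * q i ^ b) ≤ (∑ i, w i) * ∑ i, w i * q i ^ (a + b) := by
  -- Chebyshev's sum inequality: two powers of the same nonnegative numbers are similarly ordered.
  have h : 0 ≤ ∑ i, ∑ k, w i * w k * ((q i ^ a - q k ^ a) * (q i ^ b - q k ^ b)) := by
    refine Finset.sum_nonneg fun i _ => Finset.sum_nonneg fun k _ =>
      mul_nonneg (mul_nonneg (hw i) (hw k)) ?_
    rcases le_total (q i) (q k) with h | h
    · exact mul_nonneg_of_nonpos_of_nonpos (sub_nonpos.2 (pow_le_pow_left₀ (hq i) h a))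
        (sub_nonpos.2 (pow_le_pow_left₀ (hq i) h b))
    · exact mul_nonneg (sub_nonneg.2 (pow_le_pow_left₀ (hq k) h a))
        (sub_nonneg.2 (pow_le_pow_left₀ (hq k) h b))
  have e : ∑ i, ∑ k, w i * w k * ((q i ^ a - q k ^ a) * (q i ^ b - q k ^ b)) =
      2 * ((∑ i, w i) * ∑ i, w i * q i ^ (a + b)) -
      2 * ((∑ i, w i * q i ^ a) * (∑ i, w i * q i ^ b)) := by
    have e1 (i k : ι) : w i * w k * ((q i ^ a - q k ^ a) * (q i ^ b - q k ^ b)) =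
        (w i * q i ^ (a + b)) * w k + w i * (w k * q k ^ (a + b)) -
        (w i * q i ^ a) * (w k * q k ^ b) - (w i * q i ^ b) * (w k * q k ^ a) := by ring
    simp_rw [e1, Finset.sum_sub_distrib, Finset.sum_add_distrib, ← Finset.sum_mul_sum]
    ring
  linarith

theorem dotProduct_vecMulVec_mulVec {ι : Type*} [Fintype ι] (u v : ι → ℝ) :
    v ⬝ᵥ (vecMulVec u u *ᵥ v) = (u ⬝ᵥ v) ^ 2 := by
  rw [vecMulVec_mulVec, op_smul_eq_smul, dotProduct_smul, smul_eq_mul, dotProduct_comm v u, sq]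

theorem isHermitian_vecMulVec_self {ι : Type*} (u : ι → ℝ) : (vecMulVec u u).IsHermitian := by
  ext i j; simp [vecMulVec_apply, mul_comm]

section RankOne

variable {ι : Type*} [Fintype ι] [DecidableEq ι]

/-- The moments of a symmetric matrix in terms of its eigenvalues. -/
theorem Matrix.IsHermitian.dotProduct_pow_mulVec {A : Matrix ι ι ℝ} (hA : A.IsHermitian)
    (u : ι → ℝ) (j : ℕ) :
    u ⬝ᵥ (A ^ j *ᵥ u) =
      ∑ i, (star (hA.eigenvectorUnitary : Matrix ι ι ℝ) *ᵥ u) i ^ 2 * hA.eigenvalues i ^ j := by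
  set V : Matrix ι ι ℝ := ↑hA.eigenvectorUnitary with hV
  have h := congrArg (· ^ j) hA.spectral_theorem
  beta_reduce at h
  rw [← map_pow, diagonal_pow, Unitary.conjStarAlgAut_apply, ← hV] at h
  rw [h, ← mulVec_mulVec, ← mulVec_mulVec, dotProduct_mulVec, ← mulVec_transpose]
  have : (V)ᵀ = star V := by simp [star_eq_conjTranspose]
  change ((V)ᵀ *ᵥ u) ⬝ᵥ _ = _
  rw [this, dotProduct]
  refine Finset.sum_congr rfl fun i _ => ?_
  rw [mulVec_diagonal]
  simp
  ring

theorem Matrix.IsHermitian.trace_pow_eq_sum {A : Matrix ι ι ℝ} (hA : A.IsHermitian) (j : ℕ) :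
    (A ^ j).trace = ∑ i, hA.eigenvalues i ^ j := by
  have h := congrArg (· ^ j) hA.spectral_theorem
  beta_reduce at h
  rw [← map_pow, diagonal_pow, Unitary.conjStarAlgAut_apply] at h
  rw [h, trace_mul_cycle, Unitary.coe_star_mul_self, one_mul, trace_diagonal]
  simp

theorem Matrix.IsHermitian.exists_eigenvector {A : Matrix ι ι ℝ} (hA : A.IsHermitian) (i : ι) :
    ∃ v : ι → ℝ, v ⬝ᵥ v = 1 ∧ A *ᵥ v = hA.eigenvalues i • v := by
  refine ⟨hA.eigenvectorBasis i, ?_, hA.mulVec_eigenvectorBasis i⟩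
  have h := hA.eigenvectorBasis.orthonormal.1 i
  have h2 := real_inner_self_eq_norm_sq (hA.eigenvectorBasis i)
  rw [h, EuclideanSpace.inner_eq_star_dotProduct] at h2
  simpa using h2

theorem Matrix.IsHermitian.le_eigenvalues {A : Matrix ι ι ℝ} (hA : A.IsHermitian) {r : ℝ}
    (h : ∀ v, r * (v ⬝ᵥ v) ≤ v ⬝ᵥ (A *ᵥ v)) (i : ι) : r ≤ hA.eigenvalues i := by
  obtain ⟨v, hv, hAv⟩ := hA.exists_eigenvector i
  simpa [hAv, hv] using h v

theorem Matrix.IsHermitian.eigenvalues_le {A : Matrix ι ι ℝ} (hA : A.IsHermitian) {r : ℝ}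
    (h : ∀ v, v ⬝ᵥ (A *ᵥ v) ≤ r * (v ⬝ᵥ v)) (i : ι) : hA.eigenvalues i ≤ r := by
  obtain ⟨v, hv, hAv⟩ := hA.exists_eigenvector i
  simpa [hAv, hv] using h v

/-- Chebyshev's sum inequality for the spectral measure of `A` at `u`. It collapses the products of
moments that arise on differentiating `u ⬝ᵥ (A ^ k *ᵥ u)` along a rank one direction. -/
theorem Matrix.IsHermitian.dotProduct_pow_mulVec_mul_le {A : Matrix ι ι ℝ} (hA : A.IsHermitian)
    (h0 : ∀ v, 0 ≤ v ⬝ᵥ (A *ᵥ v)) (u : ι → ℝ) (a b : ℕ) :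
    (u ⬝ᵥ (A ^ a *ᵥ u)) * (u ⬝ᵥ (A ^ b *ᵥ u)) ≤ (u ⬝ᵥ u) * (u ⬝ᵥ (A ^ (a + b) *ᵥ u)) := by
  have h1 := hA.dotProduct_pow_mulVec u 0
  simp only [pow_zero, one_mulVec, mul_one] at h1
  rw [h1]
  simp only [hA.dotProduct_pow_mulVec]
  exact sum_mul_pow_mul_sum_mul_pow_le _ _ (fun i => sq_nonneg _)
    (hA.le_eigenvalues (by simpa using h0)) a b

theorem Matrix.IsHermitian.mul_dotProduct_pow_mulVec_le {A : Matrix ι ι ℝ} (hA : A.IsHermitian)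
    {r : ℝ} (hr : 0 ≤ r) (h0 : ∀ v, r * (v ⬝ᵥ v) ≤ v ⬝ᵥ (A *ᵥ v)) (u : ι → ℝ) (j : ℕ) :
    r * (u ⬝ᵥ (A ^ j *ᵥ u)) ≤ u ⬝ᵥ (A ^ (j + 1) *ᵥ u) := by
  simp only [hA.dotProduct_pow_mulVec, Finset.mul_sum]
  refine Finset.sum_le_sum fun i _ => ?_
  have h := hA.le_eigenvalues h0 i
  rw [mul_left_comm, pow_succ' (hA.eigenvalues i)]
  exact mul_le_mul_of_nonneg_left (mul_le_mul_of_nonneg_right h (pow_nonneg (hr.trans h) j))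
    (sq_nonneg _)

theorem Matrix.IsHermitian.dotProduct_pow_mulVec_nonneg {A : Matrix ι ι ℝ} (hA : A.IsHermitian)
    (h0 : ∀ v, 0 ≤ v ⬝ᵥ (A *ᵥ v)) (u : ι → ℝ) (j : ℕ) : 0 ≤ u ⬝ᵥ (A ^ j *ᵥ u) := by
  rw [hA.dotProduct_pow_mulVec]
  have h := hA.le_eigenvalues (r := 0) (by simpa using h0)
  exact Finset.sum_nonneg fun i _ => mul_nonneg (sq_nonneg _) (pow_nonneg (h i) _)

section Deriv

open scoped Matrix.Norms.Operator

theorem hasDerivAt_sub_smul_pow (A B : Matrix ι ι ℝ) (n : ℕ) (s : ℝ) :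
    HasDerivAt (fun s : ℝ => (A - s • B) ^ n)
      (∑ i ∈ Finset.range n, (A - s • B) ^ (n - 1 - i) * (-B) * (A - s • B) ^ i) s := by
  have h : HasDerivAt (fun s : ℝ => A - s • B) (-B) s := by
    convert! ((hasDerivAt_id s).smul_const B).const_sub A using 1
    simp
  exact h.fun_pow' n

theorem hasDerivAt_linear_sub_smul_pow (f : Matrix ι ι ℝ →ₗ[ℝ] ℝ) (A B : Matrix ι ι ℝ) (n : ℕ)
    (s : ℝ) :
    HasDerivAt (fun s : ℝ => f ((A - s • B) ^ n))
      (-∑ i ∈ Finset.range n, f ((A - s • B) ^ (n - 1 - i) * B * (A - s • B) ^ i)) s := by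
  have h := (LinearMap.toContinuousLinearMap f).hasFDerivAt.comp_hasDerivAt s
    (hasDerivAt_sub_smul_pow A B n s)
  have e : f (∑ i ∈ Finset.range n, (A - s • B) ^ (n - 1 - i) * (-B) * (A - s • B) ^ i) =
      -∑ i ∈ Finset.range n, f ((A - s • B) ^ (n - 1 - i) * B * (A - s • B) ^ i) := by
    simp only [mul_neg, neg_mul, Finset.sum_neg_distrib, map_neg, map_sum]
  rw [← e]
  exact h

end Deriv

theorem hasDerivAt_trace_sub_smul_pow (W : Matrix ι ι ℝ) (u : ι → ℝ) (e : ℝ) (k : ℕ) (s : ℝ) :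
    HasDerivAt (fun s : ℝ => ((W - s • (e • vecMulVec u u)) ^ (k + 1)).trace)
      (-(e * (k + 1) * (u ⬝ᵥ ((W - s • (e • vecMulVec u u)) ^ k *ᵥ u)))) s := by
  convert! hasDerivAt_linear_sub_smul_pow (traceLinearMap ι ℝ ℝ) W (e • vecMulVec u u) (k + 1) s
    using 2
  set Q := W - s • (e • vecMulVec u u)
  have (i : ℕ) (hi : i ∈ Finset.range (k + 1)) :
      traceLinearMap ι ℝ ℝ (Q ^ (k + 1 - 1 - i) * (e • vecMulVec u u) * Q ^ i) =
        e * (u ⬝ᵥ (Q ^ k *ᵥ u)) := by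
    rw [traceLinearMap_apply, trace_mul_cycle, ← pow_add, mul_smul_comm, trace_smul,
      mul_vecMulVec, trace_vecMulVec, dotProduct_comm, smul_eq_mul]
    congr 5
    have := Finset.mem_range.1 hi
    omega
  rw [Finset.sum_congr rfl this]
  simp
  ring

theorem hasDerivAt_dotProduct_sub_smul_pow (W : Matrix ι ι ℝ) (u : ι → ℝ) (e : ℝ) (k : ℕ) (s : ℝ) :
    HasDerivAt (fun s : ℝ => u ⬝ᵥ ((W - s • (e • vecMulVec u u)) ^ k *ᵥ u))
      (-∑ i ∈ Finset.range k, e * ((u ⬝ᵥ ((W - s • (e • vecMulVec u u)) ^ (k - 1 - i) *ᵥ u)) *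
        (u ⬝ᵥ ((W - s • (e • vecMulVec u u)) ^ i *ᵥ u)))) s := by
  let f : Matrix ι ι ℝ →ₗ[ℝ] ℝ :=
    { toFun := fun A => u ⬝ᵥ (A *ᵥ u)
      map_add' := fun A B => by simp [add_mulVec, dotProduct_add]
      map_smul' := fun c A => by simp [smul_mulVec, dotProduct_smul] }
  convert! hasDerivAt_linear_sub_smul_pow f W (e • vecMulVec u u) k s using 2
  refine Finset.sum_congr rfl fun i _ => ?_
  simp only [f, LinearMap.coe_mk, AddHom.coe_mk]
  rw [← mulVec_mulVec, ← mulVec_mulVec, smul_mulVec, mulVec_smul, dotProduct_smul, smul_eq_mul,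
    vecMulVec_mulVec, op_smul_eq_smul, mulVec_smul, dotProduct_smul, smul_eq_mul]
  ring

/-- The effect of a rank one update on the trace of a power of a matrix: a polynomial form of the
Golden–Thompson inequality for a rank one summand. -/
theorem trace_sub_vecMulVec_pow_le {W : Matrix ι ι ℝ} (hW : W.IsHermitian) (u : ι → ℝ)
    {e r ρ c : ℝ} (he : 0 ≤ e) (hr : 0 < r) (hu : u ⬝ᵥ u ≤ ρ)
    (hWr : ∀ v, r * (v ⬝ᵥ v) + e * (u ⬝ᵥ v) ^ 2 ≤ v ⬝ᵥ (W *ᵥ v)) (k : ℕ)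
    (hc : c = e * (k + 1) * ρ / r) (hc0 : 0 < c) :
    ((W - e • vecMulVec u u) ^ (k + 1)).trace ≤
      (W ^ (k + 1)).trace -
        e * (k + 1) * ((1 - Real.exp (-c)) / c) * (u ⬝ᵥ (W ^ k *ᵥ u)) := by
  set Q : ℝ → Matrix ι ι ℝ := fun s => W - s • (e • vecMulVec u u) with hQ
  have hQH (s : ℝ) : (Q s).IsHermitian :=
    hW.sub (((isHermitian_vecMulVec_self u).smul (by simp [isSelfAdjoint_iff])).smul (by simp [isSelfAdjoint_iff]))
  have hQr (s : ℝ) (hs : s ≤ 1) (v : ι → ℝ) : r * (v ⬝ᵥ v) ≤ v ⬝ᵥ (Q s *ᵥ v) := by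
    have h1 := hWr v
    simp only [hQ, sub_mulVec, smul_mulVec, dotProduct_sub, dotProduct_smul, smul_eq_mul,
      dotProduct_vecMulVec_mulVec]
    have h2 : s * (e * (u ⬝ᵥ v) ^ 2) ≤ 1 * (e * (u ⬝ᵥ v) ^ 2) := by gcongr
    linarith
  have hQ0 (s : ℝ) (hs : s ≤ 1) (v : ι → ℝ) : 0 ≤ v ⬝ᵥ (Q s *ᵥ v) :=
    (mul_nonneg hr.le (by simpa using dotProduct_star_self_nonneg v)).trans (hQr s hs v)
  set F : ℝ → ℝ := fun s => (Q s ^ (k + 1)).trace with hF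
  set G : ℝ → ℝ := fun s => u ⬝ᵥ (Q s ^ k *ᵥ u) with hG
  set G' : ℝ → ℝ := fun s => -∑ i ∈ Finset.range k, e * ((u ⬝ᵥ (Q s ^ (k - 1 - i) *ᵥ u)) *
    (u ⬝ᵥ (Q s ^ i *ᵥ u))) with hG'
  have hFd (s : ℝ) : HasDerivAt F (-(e * (k + 1) * G s)) s := hasDerivAt_trace_sub_smul_pow W u e k s
  have hGd (s : ℝ) : HasDerivAt G (G' s) s := hasDerivAt_dotProduct_sub_smul_pow W u e k s
  have hρ : 0 ≤ ρ := le_trans (by simpa using dotProduct_star_self_nonneg u) hu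
  -- Each of the `k` products in `G'` is at most `ρ` times the moment of order `k - 1`, which is at
  -- most `G / r`. The factor `k + 1` in `c`, one more than needed here, keeps `c` positive when `k
  -- = 0`.
  have hGlow (s : ℝ) (hs : s ≤ 1) : 0 ≤ G' s + c * G s := by
    have hGs : 0 ≤ G s := (hQH s).dotProduct_pow_mulVec_nonneg (hQ0 s hs) u k
    rcases k with _ | k
    · simp only [hG', Finset.range_zero, Finset.sum_empty, neg_zero, zero_add]
      positivity
    · set b := u ⬝ᵥ (Q s ^ k *ᵥ u) with hb
      have hb0 : 0 ≤ b := (hQH s).dotProduct_pow_mulVec_nonneg (hQ0 s hs) u k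
      have h1 : ∑ i ∈ Finset.range (k + 1), e * ((u ⬝ᵥ (Q s ^ (k + 1 - 1 - i) *ᵥ u)) *
          (u ⬝ᵥ (Q s ^ i *ᵥ u))) ≤ ∑ i ∈ Finset.range (k + 1), e * (ρ * b) := by
        refine Finset.sum_le_sum fun i hi => mul_le_mul_of_nonneg_left ?_ he
        refine ((hQH s).dotProduct_pow_mulVec_mul_le (hQ0 s hs) u _ _).trans ?_
        have : k + 1 - 1 - i + i = k := by have := Finset.mem_range.1 hi; omega
        rw [this]
        gcongr
      have h2 : r * b ≤ G s := (hQH s).mul_dotProduct_pow_mulVec_le hr.le (hQr s hs) u k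
      rw [Finset.sum_const, Finset.card_range, nsmul_eq_mul] at h1
      have h3 : c * (r * b) ≤ c * G s := by gcongr
      have h4 : c * (r * b) = e * ((k + 1 : ℕ) + 1) * ρ * b := by
        rw [hc]; field_simp
      have h5 : 0 ≤ e * (ρ * b) := by positivity
      simp only [hG']
      push_cast at h1 h4 ⊢
      linarith
  have hexp (s : ℝ) : HasDerivAt (fun s => Real.exp (c * s)) (c * Real.exp (c * s)) s := by
    simpa [mul_comm] using (((hasDerivAt_id s).const_mul c).exp)
  have hexp' (s : ℝ) : HasDerivAt (fun s => Real.exp (-(c * s))) (-(c * Real.exp (-(c * s)))) s := by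
    simpa [mul_comm] using (((hasDerivAt_id s).const_mul c).neg.exp)
  have hint {s : ℝ} (hs : s ∈ interior (Set.Icc (0 : ℝ) 1)) : s ≤ 1 :=
    (interior_subset hs : s ∈ Set.Icc (0 : ℝ) 1).2
  have hGexp (s : ℝ) (h0 : 0 ≤ s) (h1 : s ≤ 1) : G 0 * Real.exp (-(c * s)) ≤ G s := by
    have hd (s : ℝ) := (hGd s).mul (hexp s)
    have hm : MonotoneOn (G * fun s => Real.exp (c * s)) (Set.Icc 0 1) := by
      refine monotoneOn_of_deriv_nonneg (convex_Icc 0 1)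
        (continuous_iff_continuousAt.2 fun s => (hd s).continuousAt).continuousOn
        (fun s _ => (hd s).differentiableAt.differentiableWithinAt) fun s hs => ?_
      rw [(hd s).deriv]
      have := mul_nonneg (hGlow s (hint hs)) (Real.exp_pos (c * s)).le
      linarith
    have h2 := hm (Set.left_mem_Icc.2 zero_le_one) ⟨h0, h1⟩ h0
    simp only [Pi.mul_apply, mul_zero, Real.exp_zero, mul_one] at h2
    rw [Real.exp_neg, ← div_eq_mul_inv, div_le_iff₀ (Real.exp_pos _)]
    exact h2
  -- The integrated form of `F' = -e (k + 1) G ≤ -e (k + 1) G(0) exp(-c s)` over `[0, 1]`.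
  have hfin : F 1 - e * (k + 1) * (G 0 / c) * Real.exp (-(c * 1)) ≤
      F 0 - e * (k + 1) * (G 0 / c) * Real.exp (-(c * 0)) := by
    have hd (s : ℝ) := (hFd s).sub ((hexp' s).const_mul (e * (k + 1) * (G 0 / c)))
    have hm : AntitoneOn (F - fun s => e * (k + 1) * (G 0 / c) * Real.exp (-(c * s)))
        (Set.Icc 0 1) := by
      refine antitoneOn_of_deriv_nonpos (convex_Icc 0 1)
        (continuous_iff_continuousAt.2 fun s => (hd s).continuousAt).continuousOn
        (fun s _ => (hd s).differentiableAt.differentiableWithinAt) fun s hs => ?_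
      rw [(hd s).deriv]
      have h1 := hGexp s (interior_subset hs : s ∈ Set.Icc (0 : ℝ) 1).1 (hint hs)
      have h2 : e * (k + 1) * (G 0 / c) * -(c * Real.exp (-(c * s))) =
          -(e * (k + 1) * (G 0 * Real.exp (-(c * s)))) := by field_simp
      rw [h2]
      have h3 : e * (k + 1) * (G 0 * Real.exp (-(c * s))) ≤ e * (k + 1) * G s := by gcongr
      linarith
    exact hm (Set.left_mem_Icc.2 zero_le_one) (Set.right_mem_Icc.2 zero_le_one) zero_le_one
  have hF1 : F 1 = ((W - e • vecMulVec u u) ^ (k + 1)).trace := by simp [hF, hQ]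
  have hF0 : F 0 = (W ^ (k + 1)).trace := by simp [hF, hQ]
  have hG0 : G 0 = u ⬝ᵥ (W ^ k *ᵥ u) := by simp [hG, hQ]
  rw [← hF1, ← hF0, ← hG0]
  simp only [mul_one, mul_zero, neg_zero, Real.exp_zero] at hfin
  have : e * (k + 1) * ((1 - Real.exp (-c)) / c) * G 0 =
    e * (k + 1) * (G 0 / c) - e * (k + 1) * (G 0 / c) * Real.exp (-c) := by ring
  linarith

end RankOne

/-! ### Matrix Chernoff bound for the smallest eigenvalue -/

section LowerTail

variable {ι X : Type*} [Fintype ι] [DecidableEq ι] [Fintype X] [Nonempty X]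

theorem dotProduct_sq_le {ι : Type*} [Fintype ι] (u v : ι → ℝ) :
    (u ⬝ᵥ v) ^ 2 ≤ (u ⬝ᵥ u) * (v ⬝ᵥ v) := by
  have h := Finset.sum_mul_sq_le_sq_mul_sq Finset.univ u v
  simpa [dotProduct, ← sq] using h

theorem sum_dotProduct_mulVec_of_sum_vecMulVec_eq_one {ι X : Type*} [Fintype ι] [DecidableEq ι]
    [Fintype X] (u : X → ι → ℝ) (hu : ∑ x, vecMulVec (u x) (u x) = 1) (A : Matrix ι ι ℝ) :
    ∑ x, u x ⬝ᵥ (A *ᵥ u x) = A.trace := by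
  have h := congrArg (fun B => (A * B).trace) hu
  simp only [Finset.mul_sum, trace_sum, mul_one, mul_vecMulVec, trace_vecMulVec] at h
  rw [← h]
  exact Finset.sum_congr rfl fun x _ => dotProduct_comm _ _

theorem sub_vecMulVec_isHermitian {ι : Type*} {W : Matrix ι ι ℝ} (hW : W.IsHermitian) (e : ℝ)
    (u : ι → ℝ) : (W - e • vecMulVec u u).IsHermitian :=
  hW.sub ((isHermitian_vecMulVec_self u).smul (by simp [isSelfAdjoint_iff]))

theorem dotProduct_sub_smul_vecMulVec_mulVec {ι : Type*} [Fintype ι] (W : Matrix ι ι ℝ) (e : ℝ)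
    (u v : ι → ℝ) :
    v ⬝ᵥ ((W - e • vecMulVec u u) *ᵥ v) = v ⬝ᵥ (W *ᵥ v) - e * (u ⬝ᵥ v) ^ 2 := by
  rw [sub_mulVec, dotProduct_sub, smul_mulVec, dotProduct_smul, dotProduct_vecMulVec_mulVec,
    smul_eq_mul]

/-- One step of the trace recursion for a random rank one update with isotropic distribution. -/
theorem expect_trace_sub_vecMulVec_pow_le (u : X → ι → ℝ) (hu : ∑ x, vecMulVec (u x) (u x) = 1)
    {e r ρ c : ℝ} (he : 0 < e) (hr : 0 < r) (hρ0 : 0 < ρ) (hρ : ∀ x, u x ⬝ᵥ u x ≤ ρ)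
    (k : ℕ) (hc : c = e * (k + 1) * ρ / r) {W : Matrix ι ι ℝ} (hW : W.IsHermitian)
    (hWr : ∀ v, (r + e * ρ) * (v ⬝ᵥ v) ≤ v ⬝ᵥ (W *ᵥ v))
    (hW1 : ∀ v, v ⬝ᵥ (W *ᵥ v) ≤ 1 * (v ⬝ᵥ v)) :
    𝔼 x, ((W - e • vecMulVec (u x) (u x)) ^ (k + 1)).trace ≤
      (1 - (1 - Real.exp (-c)) * (r / (ρ * Fintype.card X))) * (W ^ (k + 1)).trace := by
  have hc0 : 0 < c := by rw [hc]; positivity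
  have hvv (v : ι → ℝ) : 0 ≤ v ⬝ᵥ v := by simpa using dotProduct_star_self_nonneg v
  have h1 (x : X) := trace_sub_vecMulVec_pow_le hW (u x) he.le hr (hρ x) (fun v => by
    have h2 := dotProduct_sq_le (u x) v
    have h3 := mul_le_mul_of_nonneg_right (hρ x) (hvv v)
    have h4 := mul_le_mul_of_nonneg_left (h2.trans h3) he.le
    have := hWr v
    linarith) k hc hc0
  refine (Finset.expect_le_expect fun x _ => h1 x).trans ?_
  rw [Finset.expect_sub_distrib, Fintype.expect_const, ← Finset.mul_expect,
    Fintype.expect_eq_sum_div_card, sum_dotProduct_mulVec_of_sum_vecMulVec_eq_one u hu]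
  -- Isotropy produces the trace of `W ^ k`, while the recursion needs that of `W ^ (k + 1)`; the
  -- spectrum lies in `[0, 1]`, so the replacement goes in the right direction.
  have htr : (W ^ (k + 1)).trace ≤ (W ^ k).trace := by
    rw [hW.trace_pow_eq_sum, hW.trace_pow_eq_sum]
    refine Finset.sum_le_sum fun i _ => ?_
    refine pow_le_pow_of_le_one ?_ (hW.eigenvalues_le hW1 i) (Nat.le_succ k)
    exact hW.le_eigenvalues (r := 0) (fun v => by
      have h5 := hWr v
      have h6 := hvv v
      rw [zero_mul]
      exact (by positivity : 0 ≤ (r + e * ρ) * (v ⬝ᵥ v)).trans h5) i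
  have hexp : 0 ≤ 1 - Real.exp (-c) := by
    have := Real.exp_le_one_iff.2 (neg_nonpos.2 hc0.le)
    linarith
  have hN : (0 : ℝ) < Fintype.card X := by exact_mod_cast Fintype.card_pos
  have e1 : e * (k + 1) * ((1 - Real.exp (-c)) / c) * ((W ^ k).trace / Fintype.card X) =
      (1 - Real.exp (-c)) * (r / (ρ * Fintype.card X)) * (W ^ k).trace := by
    rw [hc]; field_simp
  rw [e1]
  have h7 : 0 ≤ (1 - Real.exp (-c)) * (r / (ρ * Fintype.card X)) := by positivity
  have h8 := mul_le_mul_of_nonneg_left htr h7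
  linarith

/-- Every subtraction lowers the spectrum by at most `e * ρ`. The initial margin `r + m * (e * ρ)`
therefore leaves `r` throughout, and the one-step contraction can be iterated `m` times. -/
theorem expect_trace_sub_sum_vecMulVec_pow_le (u : X → ι → ℝ)
    (hu : ∑ x, vecMulVec (u x) (u x) = 1) {e r ρ c : ℝ} (he : 0 < e) (hr : 0 < r) (hρ0 : 0 < ρ)
    (hρ : ∀ x, u x ⬝ᵥ u x ≤ ρ) (k : ℕ) (hc : c = e * (k + 1) * ρ / r)
    (hK : 0 ≤ 1 - (1 - Real.exp (-c)) * (r / (ρ * Fintype.card X))) (m : ℕ)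
    {W : Matrix ι ι ℝ} (hW : W.IsHermitian)
    (hWr : ∀ v, (r + m * (e * ρ)) * (v ⬝ᵥ v) ≤ v ⬝ᵥ (W *ᵥ v))
    (hW1 : ∀ v, v ⬝ᵥ (W *ᵥ v) ≤ 1 * (v ⬝ᵥ v)) :
    𝔼 ω : Fin m → X, ((W - e • ∑ i, vecMulVec (u (ω i)) (u (ω i))) ^ (k + 1)).trace ≤
      (1 - (1 - Real.exp (-c)) * (r / (ρ * Fintype.card X))) ^ m * (W ^ (k + 1)).trace := by
  have hvv (v : ι → ℝ) : 0 ≤ v ⬝ᵥ v := by simpa using dotProduct_star_self_nonneg v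
  induction m generalizing W with
  | zero => simp
  | succ m ih =>
    rw [expect_fin_succ]
    have hstep (x : X) := ih (sub_vecMulVec_isHermitian hW e (u x)) (fun v => by
        rw [dotProduct_sub_smul_vecMulVec_mulVec]
        have h2 := dotProduct_sq_le (u x) v
        have h3 := mul_le_mul_of_nonneg_right (hρ x) (hvv v)
        have h4 := mul_le_mul_of_nonneg_left (h2.trans h3) he.le
        have := hWr v
        push_cast at this
        linarith) (fun v => by
        rw [dotProduct_sub_smul_vecMulVec_mulVec]
        have := hW1 v
        have : 0 ≤ e * (u x ⬝ᵥ v) ^ 2 := by positivity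
        linarith)
    simp only [Fin.sum_univ_succ, Fin.cons_zero, Fin.cons_succ, smul_add, ← sub_sub]
    refine (Finset.expect_le_expect fun x _ => hstep x).trans ?_
    rw [← Finset.mul_expect, pow_succ, mul_assoc]
    refine mul_le_mul_of_nonneg_left ?_ (pow_nonneg hK m)
    refine expect_trace_sub_vecMulVec_pow_le u hu he hr hρ0 hρ k hc hW (fun v => ?_) hW1
    refine le_trans (mul_le_mul_of_nonneg_right ?_ (hvv v)) (hWr v)
    push_cast
    have : 0 ≤ m * (e * ρ) := by positivity
    linarith

/-- A Rayleigh quotient is a weighted mean of eigenvalues, so some eigenvalue reaches `a`. This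
makes Markov's inequality for the trace detect a bad direction `v`. -/
theorem Matrix.IsHermitian.pow_le_trace_pow {A : Matrix ι ι ℝ} (hA : A.IsHermitian)
    (h0 : ∀ v, 0 ≤ v ⬝ᵥ (A *ᵥ v)) {a : ℝ} (ha : 0 ≤ a) {v : ι → ℝ} (hv : v ≠ 0)
    (h : a * (v ⬝ᵥ v) ≤ v ⬝ᵥ (A *ᵥ v)) (k : ℕ) : a ^ k ≤ (A ^ k).trace := by
  have hq := hA.le_eigenvalues (r := 0) (by simpa using h0)
  obtain ⟨i, hi⟩ : ∃ i, a ≤ hA.eigenvalues i := by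
    by_contra! hcon
    have h1 := hA.dotProduct_pow_mulVec v 1
    have h2 := hA.dotProduct_pow_mulVec v 0
    simp only [pow_zero, one_mulVec, mul_one, pow_one] at h1 h2
    have hpos : 0 < v ⬝ᵥ v := by
      simpa using dotProduct_star_self_pos_iff.2 hv
    obtain ⟨i, -, hi⟩ : ∃ i ∈ Finset.univ,
        0 < (star (hA.eigenvectorUnitary : Matrix ι ι ℝ) *ᵥ v) i ^ 2 := by
      rw [h2] at hpos
      exact Finset.exists_lt_of_sum_lt (by simpa using hpos)
    rw [h1, h2, Finset.mul_sum] at h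
    refine absurd h (not_le.2 (Finset.sum_lt_sum (fun j _ => ?_) ⟨i, Finset.mem_univ i, ?_⟩))
    · rw [mul_comm]
      exact mul_le_mul_of_nonneg_right (hcon j).le (sq_nonneg _)
    · rw [mul_comm]
      exact mul_lt_mul_of_pos_right (hcon i) hi
  rw [hA.trace_pow_eq_sum]
  exact (pow_le_pow_left₀ ha hi k).trans
    (Finset.single_le_sum (f := fun i => hA.eigenvalues i ^ k) (fun j _ => pow_nonneg (hq j) k)
      (Finset.mem_univ i))

/-- Chernoff's lower tail bound for a sum of independent rank one matrices. -/
theorem freq_exists_dotProduct_sum_le (u : X → ι → ℝ) (hu : ∑ x, vecMulVec (u x) (u x) = 1)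
    {ρ θ a : ℝ} (hρ0 : 0 < ρ) (hρ1 : 1 ≤ ρ * Fintype.card X) (hρ : ∀ x, u x ⬝ᵥ u x ≤ ρ)
    (hθ : 0 < θ) (m : ℕ) :
    freq {ω : Fin m → X | ∃ v : ι → ℝ, v ≠ 0 ∧ ∑ i, (u (ω i) ⬝ᵥ v) ^ 2 ≤ a * (v ⬝ᵥ v)} *
        Real.exp (-(θ * a)) ≤
      (1 - (1 - Real.exp (-(θ * ρ))) * (1 / (ρ * Fintype.card X))) ^ m * Fintype.card ι := by
  set S : Set (Fin m → X) :=
    {ω | ∃ v : ι → ℝ, v ≠ 0 ∧ ∑ i, (u (ω i) ⬝ᵥ v) ^ 2 ≤ a * (v ⬝ᵥ v)}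
  have hvv (v : ι → ℝ) : 0 ≤ v ⬝ᵥ v := by simpa using dotProduct_star_self_nonneg v
  have hk : Filter.Tendsto (fun k : ℕ => ((k + 1 : ℕ) : ℝ)) Filter.atTop Filter.atTop :=
    tendsto_natCast_atTop_atTop.comp (Filter.tendsto_add_atTop_nat 1)
  have hdiv (b : ℝ) : Filter.Tendsto (fun k : ℕ => b / ((k + 1 : ℕ) : ℝ)) Filter.atTop
      (nhds 0) := hk.const_div_atTop b
  have hl : Filter.Tendsto
      (fun k : ℕ => freq S * (1 + (-(θ * a)) / ((k + 1 : ℕ) : ℝ)) ^ (k + 1)) Filter.atTop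
      (nhds (freq S * Real.exp (-(θ * a)))) :=
    ((Real.tendsto_one_add_div_pow_exp (-(θ * a))).comp
      (Filter.tendsto_add_atTop_nat 1)).const_mul _
  -- With step size `θ / (k + 1)`, this is what is left of the spectrum of the identity after `m`
  -- subtractions.
  set r : ℕ → ℝ := fun k => 1 - (m * (θ * ρ)) / ((k + 1 : ℕ) : ℝ) with hrdef
  have hr1 : Filter.Tendsto r Filter.atTop (nhds 1) := by
    simpa only [sub_zero] using (hdiv (m * (θ * ρ))).const_sub 1
  have hr : Filter.Tendsto
      (fun k : ℕ => (1 - (1 - Real.exp (-(θ * ρ / r k))) * (r k / (ρ * Fintype.card X))) ^ m *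
        (Fintype.card ι : ℝ)) Filter.atTop
      (nhds ((1 - (1 - Real.exp (-(θ * ρ))) * (1 / (ρ * Fintype.card X))) ^ m *
        Fintype.card ι)) := by
    have h1 : Filter.Tendsto (fun k => Real.exp (-(θ * ρ / r k))) Filter.atTop
        (nhds (Real.exp (-(θ * ρ)))) := by
      have h2 : Filter.Tendsto (fun k => θ * ρ / r k) Filter.atTop (nhds (θ * ρ / 1)) :=
        tendsto_const_nhds.div hr1 one_ne_zero
      rw [div_one] at h2
      exact (Real.continuous_exp.tendsto _).comp h2.neg
    exact ((((h1.const_sub 1).mul (hr1.div_const _)).const_sub 1).pow m).mul_const _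
  -- For finite `k`, Markov's inequality is applied to the trace of the power `k + 1`; a bad `ω` has
  -- trace at least `(1 - θ a / (k + 1)) ^ (k + 1)`.
  refine le_of_tendsto_of_tendsto hl hr ?_
  have hrpos : ∀ᶠ k in Filter.atTop, 0 < r k := hr1.eventually_const_lt zero_lt_one
  have hapos : ∀ᶠ k : ℕ in Filter.atTop, 0 < 1 + (-(θ * a)) / ((k + 1 : ℕ) : ℝ) := by
    have : Filter.Tendsto (fun k : ℕ => 1 + (-(θ * a)) / ((k + 1 : ℕ) : ℝ)) Filter.atTop
        (nhds 1) := by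
      simpa only [add_zero] using (hdiv (-(θ * a))).const_add 1
    exact this.eventually_const_lt zero_lt_one
  filter_upwards [hrpos, hapos] with k hrk hak
  set e : ℝ := θ / ((k + 1 : ℕ) : ℝ) with he
  have hk0 : (0 : ℝ) < ((k + 1 : ℕ) : ℝ) := by positivity
  have he0 : 0 < e := by positivity
  have hN : (0 : ℝ) < Fintype.card X := by exact_mod_cast Fintype.card_pos
  have hc : θ * ρ / r k = e * (k + 1) * ρ / r k := by
    rw [he]; push_cast; field_simp
  have hrle : r k ≤ 1 := by
    have : 0 ≤ (m * (θ * ρ)) / ((k + 1 : ℕ) : ℝ) := by positivity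
    simp only [hrdef]; linarith
  have hrme : r k + m * (e * ρ) = 1 := by
    simp only [hrdef, he]; ring
  have hK : 0 ≤ 1 - (1 - Real.exp (-(θ * ρ / r k))) * (r k / (ρ * Fintype.card X)) := by
    have h1 : r k / (ρ * Fintype.card X) ≤ 1 := by
      rw [div_le_one (by positivity)]; linarith
    have h2 : 0 ≤ r k / (ρ * Fintype.card X) := by positivity
    have h3 := Real.exp_pos (-(θ * ρ / r k))
    nlinarith
  have hmain := expect_trace_sub_sum_vecMulVec_pow_le u hu he0 hrk hρ0 hρ k hc hK m
    (W := 1) isHermitian_one (fun v => by rw [hrme, one_mulVec, one_mul])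
    (fun v => by rw [one_mulVec, one_mul])
  rw [one_pow, trace_one] at hmain
  have hform (ω : Fin m → X) (v : ι → ℝ) :
      v ⬝ᵥ ((1 - e • ∑ i, vecMulVec (u (ω i)) (u (ω i))) *ᵥ v) =
        v ⬝ᵥ v - e * ∑ i, (u (ω i) ⬝ᵥ v) ^ 2 := by
    rw [sub_mulVec, dotProduct_sub, smul_mulVec, dotProduct_smul, one_mulVec, sum_mulVec,
      dotProduct_sum, smul_eq_mul]
    simp only [dotProduct_vecMulVec_mulVec]
  have hpsd (ω : Fin m → X) (v : ι → ℝ) :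
      0 ≤ v ⬝ᵥ ((1 - e • ∑ i, vecMulVec (u (ω i)) (u (ω i))) *ᵥ v) := by
    rw [hform]
    have h1 : ∑ i, (u (ω i) ⬝ᵥ v) ^ 2 ≤ ∑ i : Fin m, ρ * (v ⬝ᵥ v) :=
      Finset.sum_le_sum fun i _ => (dotProduct_sq_le _ _).trans
        (mul_le_mul_of_nonneg_right (hρ _) (hvv v))
    rw [Finset.sum_const, Finset.card_univ, Fintype.card_fin, nsmul_eq_mul] at h1
    have h2 := mul_le_mul_of_nonneg_left h1 he0.le
    have h3 := mul_nonneg hrk.le (hvv v)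
    have h4 : (r k + m * (e * ρ)) * (v ⬝ᵥ v) = v ⬝ᵥ v := by rw [hrme, one_mul]
    linarith
  have hherm (ω : Fin m → X) : (1 - e • ∑ i, vecMulVec (u (ω i)) (u (ω i))).IsHermitian := by
    have h : (∑ i, vecMulVec (u (ω i)) (u (ω i))).IsHermitian :=
      isSelfAdjoint_sum _ fun i _ => isHermitian_vecMulVec_self _
    exact isHermitian_one.sub (h.smul (by simp [isSelfAdjoint_iff]))
  refine le_trans ?_ hmain
  refine le_trans (mul_le_mul_of_nonneg_right (freq_mono ?_) (pow_nonneg hak.le _))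
    (freq_mul_le_expect _ (fun ω => ?_) _)
  · rintro ω ⟨v, hv, hva⟩
    refine (hherm ω).pow_le_trace_pow (hpsd ω) hak.le hv ?_ (k + 1)
    rw [hform]
    have h1 := mul_le_mul_of_nonneg_left hva he0.le
    have h2 : (1 + (-(θ * a)) / ((k + 1 : ℕ) : ℝ)) * (v ⬝ᵥ v) =
        v ⬝ᵥ v - e * (a * (v ⬝ᵥ v)) := by rw [he]; ring
    linarith
  · rw [(hherm ω).trace_pow_eq_sum]
    have h := (hherm ω).le_eigenvalues (r := 0) (by simpa using hpsd ω)
    exact Finset.sum_nonneg fun i _ => pow_nonneg (h i) _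

/-- The smallest eigenvalue of a sum of `m` rank one samples of an isotropic family. -/
theorem freq_exists_dotProduct_sum_le_exp (u : X → ι → ℝ) (hu : ∑ x, vecMulVec (u x) (u x) = 1)
    {ρ γ : ℝ} (hρ0 : 0 < ρ) (hρ1 : 1 ≤ ρ * Fintype.card X) (hρ : ∀ x, u x ⬝ᵥ u x ≤ ρ)
    (hγ : 0 < γ) (m : ℕ) :
    freq {ω : Fin m → X | ∃ v : ι → ℝ, v ≠ 0 ∧
        ∑ i, (u (ω i) ⬝ᵥ v) ^ 2 ≤ (1 - γ) * (m / Fintype.card X) * (v ⬝ᵥ v)} ≤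
      Fintype.card ι * Real.exp (-(m * γ ^ 2 / (2 * (ρ * Fintype.card X)))) := by
  -- With `θ = γ / ρ` and `exp(-γ) ≤ 1 - γ + γ² / 2`, the exponent in units of `m / (ρ N)` is `-(γ -
  -- γ² / 2) + γ (1 - γ) = -γ² / 2`.
  have h := freq_exists_dotProduct_sum_le u hu (a := (1 - γ) * (m / Fintype.card X)) hρ0 hρ1 hρ
    (θ := γ / ρ) (by positivity) m
  have hN : (0 : ℝ) < Fintype.card X := by exact_mod_cast Fintype.card_pos
  rw [← le_div_iff₀ (Real.exp_pos _), div_mul_cancel₀ _ hρ0.ne'] at h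
  refine h.trans ?_
  rw [div_le_iff₀ (Real.exp_pos _), mul_comm, mul_assoc]
  refine mul_le_mul_of_nonneg_left ?_ (Nat.cast_nonneg _)
  set D := ρ * (Fintype.card X : ℝ) with hD
  have hD0 : 0 < D := by positivity
  have h0 : 0 ≤ 1 - (1 - Real.exp (-γ)) * (1 / D) := by
    have h1 : 1 / D ≤ 1 := by rw [div_le_one hD0]; exact hρ1
    have h2 : 0 ≤ 1 / D := by positivity
    have h3 := Real.exp_pos (-γ)
    nlinarith
  have h1 : 1 - (1 - Real.exp (-γ)) * (1 / D) ≤ Real.exp (-((γ - γ ^ 2 / 2) / D)) := by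
    refine le_trans ?_ (Real.add_one_le_exp _)
    have h2 := exp_le_one_add_add_sq_div (x := -γ) (b := 0) (by norm_num) (by linarith)
    have h3 : (γ - γ ^ 2 / 2) / D ≤ (1 - Real.exp (-γ)) * (1 / D) := by
      rw [mul_one_div]
      norm_num at h2
      exact div_le_div_of_nonneg_right (by linarith) hD0.le
    linarith
  refine (pow_le_pow_left₀ h0 h1 m).trans (le_of_eq ?_)
  rw [← Real.exp_nat_mul, ← Real.exp_add]
  congr 1
  rw [hD]
  field_simp
  ring

end LowerTail

/-! ### Tube operations in the untransformed domain -/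

section TubeAlgebra

variable {n : ℕ} [NeZero n]

theorem tubeMul_apply (a b : ZMod n → ℝ) (k : ZMod n) :
    tubeMul a b k = ∑ j, a (k - j) * b j := by
  apply Complex.ofReal_injective
  have h : ZMod.dft (fun k : ZMod n => ((∑ j, a (k - j) * b j : ℝ) : ℂ)) =
      fun l => tubeDFT a l * tubeDFT b l := by
    funext l
    simp only [tubeDFT, ZMod.dft_apply, smul_eq_mul, Complex.ofReal_sum, Complex.ofReal_mul,
      Finset.sum_mul_sum]
    simp only [Finset.mul_sum]
    rw [Finset.sum_comm, Finset.sum_comm (s := Finset.univ) (f := fun i j => _ * _ * (_ * _))]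
    refine Finset.sum_congr rfl fun j _ => ?_
    rw [← Equiv.sum_comp (Equiv.addRight j)]
    refine Finset.sum_congr rfl fun i _ => ?_
    simp only [Equiv.coe_addRight, add_sub_cancel_right]
    rw [add_mul, neg_add, AddChar.map_add_eq_mul]
    ring
  rw [coe_tubeMul, ← h, LinearEquiv.symm_apply_apply]

theorem tubeOne_apply (k : ZMod n) : (tubeOne k : ℝ) = if k = 0 then 1 else 0 := by
  apply Complex.ofReal_injective
  have h : ZMod.dft (fun k : ZMod n => (((if k = 0 then 1 else 0 : ℝ)) : ℂ)) = fun _ => 1 := by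
    funext l
    rw [ZMod.dft_apply, Finset.sum_eq_single 0] <;> simp +contextual
  rw [coe_tubeOne, ← h, LinearEquiv.symm_apply_apply]

theorem tubeConj_apply (a : ZMod n → ℝ) (k : ZMod n) : tubeConj a k = a (-k) := by
  apply Complex.ofReal_injective
  have h : ZMod.dft (fun k : ZMod n => ((a (-k) : ℝ) : ℂ)) = fun l => star (tubeDFT a l) := by
    rw [ZMod.dft_comp_neg (fun k => ((a k : ℝ) : ℂ))]
    funext l
    exact tubeDFT_neg a l
  rw [coe_tubeConj, ← h, LinearEquiv.symm_apply_apply]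

end TubeAlgebra

theorem bcirc_injective {n₁ n₂ n₃ : ℕ} :
    Function.Injective (bcirc : Tensor n₁ n₂ n₃ → Matrix (Fin n₁ × ZMod n₃) (Fin n₂ × ZMod n₃) ℝ) := by
  intro A B h
  funext i j k
  simpa [bcirc] using congrFun (congrFun h (i, k)) (j, 0)

/-! ### Passage from tensors to block circulant matrices -/

section Bcirc

variable {n₁ n₂ n₃ n₄ : ℕ} [NeZero n₃]

theorem bcirc_lprod (A : Tensor n₁ n₂ n₃) (B : Tensor n₂ n₄ n₃) :
    bcirc (lprod A B) = bcirc A * bcirc B := by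
  ext ⟨i, k⟩ ⟨j, l⟩
  simp only [bcirc, lprod, of_apply, mul_apply, Finset.sum_apply, tubeMul_apply,
    Fintype.sum_prod_type]
  refine Finset.sum_congr rfl fun s _ => ?_
  rw [← Equiv.sum_comp (Equiv.subRight l)]
  simp

theorem bcirc_ltranspose (A : Tensor n₁ n₂ n₃) : bcirc (ltranspose A) = (bcirc A)ᵀ := by
  ext ⟨i, k⟩ ⟨j, l⟩
  simp [bcirc, ltranspose, tubeConj_apply]

theorem bcirc_lone (n : ℕ) : bcirc (lone n n₃) = 1 := by
  ext ⟨i, k⟩ ⟨j, l⟩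
  by_cases h : i = j
  · simp [bcirc, lone, tubeOne_apply, one_apply, h, sub_eq_zero]
  · simp [bcirc, lone, one_apply, h]

/-- `linv` picks some two-sided inverse; the left identity law, transferred through
`bcirc_injective`, leaves only one candidate. -/
theorem linv_lone (n : ℕ) : linv (lone n n₃) = lone n n₃ := by
  have hone (B : Tensor n n n₃) : lprod (lone n n₃) B = B :=
    bcirc_injective (by rw [bcirc_lprod, bcirc_lone, Matrix.one_mul])
  have h : ∃ B : Tensor n n n₃, lprod (lone n n₃) B = lone n n₃ ∧ lprod B (lone n n₃) = lone n n₃ :=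
    ⟨_, hone _, hone _⟩
  rw [linv, dif_pos h, ← hone h.choose]
  exact h.choose_spec.1

theorem transpose_bcirc_mul_bcirc {U : Tensor n₁ n₂ n₃}
    (hU : lprod (ltranspose U) U = lone n₂ n₃) : (bcirc U)ᵀ * bcirc U = 1 := by
  rw [← bcirc_ltranspose, ← bcirc_lprod, hU, bcirc_lone]

theorem bcirc_tensorProj {U : Tensor n₁ n₂ n₃} (hU : lprod (ltranspose U) U = lone n₂ n₃) :
    bcirc (tensorProj U) = bcirc U * (bcirc U)ᵀ := by
  rw [tensorProj, bcirc_lprod, bcirc_lprod, hU, linv_lone, bcirc_lone, Matrix.mul_one,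
    bcirc_ltranspose]

theorem unfold_lprod (A : Tensor n₁ n₂ n₃) (T : Tensor n₂ 1 n₃) :
    (unfold (lprod A T)).ofLp = bcirc A *ᵥ (unfold T).ofLp := by
  ext ⟨i, k⟩
  simp only [unfold, lprod, Finset.sum_apply, tubeMul_apply, mulVec, dotProduct, bcirc, of_apply,
    Fintype.sum_prod_type]

theorem frobNorm_sq_eq (T : Tensor n₁ 1 n₃) :
    frobNorm T ^ 2 = (unfold T).ofLp ⬝ᵥ (unfold T).ofLp := by
  rw [frobNorm, Real.sq_sqrt (by positivity)]
  simp [unfold, dotProduct, Fintype.sum_prod_type, sq]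

end Bcirc

/-! ### Coherence, row norms and the orthogonal decomposition -/

section Coherence

variable {n₁ n₂ n₃ : ℕ} [NeZero n₃] {U : Tensor n₁ n₂ n₃}

/-- Rows in different blocks differ by reindexing each tube, so their norms do not depend on `p.2`.
This is why a maximum over `n₁` basis columns controls all `n₁ n₃` rows. -/
theorem bcirc_row_dotProduct_row (U : Tensor n₁ n₂ n₃) (p : Fin n₁ × ZMod n₃) :
    bcirc U p ⬝ᵥ bcirc U p = ∑ j, ∑ k, U p.1 j k ^ 2 := by
  simp only [dotProduct, bcirc, of_apply, Fintype.sum_prod_type, ← sq]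
  refine Finset.sum_congr rfl fun j _ => ?_
  exact Equiv.sum_comp (Equiv.subLeft p.2) (fun k => U p.1 j k ^ 2)

theorem sum_vecMulVec_bcirc (hU : lprod (ltranspose U) U = lone n₂ n₃) :
    ∑ p, vecMulVec (bcirc U p) (bcirc U p) = 1 := by
  rw [← transpose_bcirc_mul_bcirc hU]
  ext q q'
  simp [Matrix.sum_apply, mul_apply, vecMulVec_apply]

/-- The basis column unfolds to a standard basis vector, and a matrix with orthonormal columns
preserves the norm of the corresponding row. -/
theorem frobNorm_tensorProj_lbasis_sq (hU : lprod (ltranspose U) U = lone n₂ n₃) (j : Fin n₁) :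
    frobNorm (lprod (tensorProj U) (lbasis n₃ j)) ^ 2 = ∑ i, ∑ k, U j i k ^ 2 := by
  have hE : (unfold (lbasis n₃ j)).ofLp = Pi.single (j, (0 : ZMod n₃)) 1 := by
    ext ⟨i, k⟩
    by_cases hi : i = j
    · by_cases hk : k = 0 <;> simp [unfold, lbasis, tubeOne_apply, hi, hk]
    · simp [unfold, lbasis, hi]
  rw [frobNorm_sq_eq, unfold_lprod, hE, bcirc_tensorProj hU, ← mulVec_mulVec, dotProduct_mulVec,
    ← mulVec_transpose, mulVec_mulVec, transpose_bcirc_mul_bcirc hU, one_mulVec, mulVec_single_one,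
    ← bcirc_row_dotProduct_row U (j, 0)]
  rfl

/-- The coherence bounds the rows of the block circulant matrix. -/
theorem exists_row_bound [NeZero n₁] [NeZero n₂] (hU : lprod (ltranspose U) U = lone n₂ n₃) :
    ∃ ρ : ℝ, 0 < ρ ∧ (∀ p, bcirc U p ⬝ᵥ bcirc U p ≤ ρ) ∧
      1 ≤ ρ * Fintype.card (Fin n₁ × ZMod n₃) ∧
      n₂ * n₃ * tensorCoherence U = ρ * Fintype.card (Fin n₁ × ZMod n₃) := by
  set ρ : ℝ := ⨆ j : Fin n₁, ∑ i, ∑ k, U j i k ^ 2 with hρ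
  have hN : (0 : ℝ) < Fintype.card (Fin n₁ × ZMod n₃) := by exact_mod_cast Fintype.card_pos
  have hle (p : Fin n₁ × ZMod n₃) : bcirc U p ⬝ᵥ bcirc U p ≤ ρ := by
    rw [bcirc_row_dotProduct_row]
    exact le_ciSup (f := fun j : Fin n₁ => ∑ i, ∑ k, U j i k ^ 2) (Set.finite_range _).bddAbove p.1
  -- The squared row norms sum to the trace of the identity, which is `n₂ n₃ ≥ 1`.
  have h1 : 1 ≤ ρ * Fintype.card (Fin n₁ × ZMod n₃) := by
    have h2 := congrArg trace (sum_vecMulVec_bcirc hU)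
    rw [trace_sum, trace_one] at h2
    simp only [trace_vecMulVec] at h2
    have h3 : ∑ p, bcirc U p ⬝ᵥ bcirc U p ≤ ∑ p : Fin n₁ × ZMod n₃, ρ :=
      Finset.sum_le_sum fun p _ => hle p
    rw [h2, Finset.sum_const, Finset.card_univ, nsmul_eq_mul, mul_comm] at h3
    refine le_trans ?_ h3
    exact_mod_cast Fintype.card_pos
  refine ⟨ρ, pos_of_mul_pos_left (zero_lt_one.trans_le h1) hN.le, hle, h1, ?_⟩
  have hn₂ : (n₂ : ℝ) ≠ 0 := NeZero.ne _
  simp only [tensorCoherence, frobNorm_tensorProj_lbasis_sq hU, ← hρ, Fintype.card_prod,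
    Fintype.card_fin, ZMod.card]
  push_cast
  field_simp

theorem exists_mulVec_of_mem_vecSubspace {x : EuclideanSpace ℝ (Fin n₁ × ZMod n₃)}
    (hx : x ∈ vecSubspace U) : ∃ a, x.ofLp = bcirc U *ᵥ a := by
  induction hx using Submodule.span_induction with
  | mem x h =>
    obtain ⟨q, rfl⟩ := h
    exact ⟨Pi.single q 1, by simp⟩
  | zero => exact ⟨0, by simp⟩
  | add x y _ _ hx hy =>
    obtain ⟨a, ha⟩ := hx
    obtain ⟨b, hb⟩ := hy
    exact ⟨a + b, by simp [mulVec_add, ha, hb]⟩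
  | smul c x _ hx =>
    obtain ⟨a, ha⟩ := hx
    exact ⟨c • a, by simp [mulVec_smul, ha]⟩

theorem transpose_bcirc_mulVec_eq_zero {y : EuclideanSpace ℝ (Fin n₁ × ZMod n₃)}
    (hy : y ∈ (vecSubspace U)ᗮ) : (bcirc U)ᵀ *ᵥ y.ofLp = 0 := by
  ext q
  have h := Submodule.inner_right_of_mem_orthogonal
    (Submodule.subset_span (Set.mem_range_self q) : WithLp.toLp 2 ((bcirc U).col q) ∈ vecSubspace U)
    hy
  rw [EuclideanSpace.inner_eq_star_dotProduct] at h
  rw [mulVec, dotProduct_comm]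
  exact h

/-- The residual energy is the energy of the orthogonal component. -/
theorem frobNorm_sub_tensorProj_sq (hU : lprod (ltranspose U) U = lone n₂ n₃)
    {T : Tensor n₁ 1 n₃} {x y : EuclideanSpace ℝ (Fin n₁ × ZMod n₃)} (hx : x ∈ vecSubspace U)
    (hy : y ∈ (vecSubspace U)ᗮ) (hxy : unfold T = x + y) :
    frobNorm (T - lprod (tensorProj U) T) ^ 2 = ‖y‖ ^ 2 := by
  obtain ⟨a, ha⟩ := exists_mulVec_of_mem_vecSubspace hx
  have h0 := transpose_bcirc_mulVec_eq_zero hy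
  have h : (unfold (T - lprod (tensorProj U) T)).ofLp = y.ofLp := by
    have h1 : (unfold (T - lprod (tensorProj U) T)).ofLp =
        (unfold T).ofLp - (unfold (lprod (tensorProj U) T)).ofLp := by
      ext p; simp [unfold]
    rw [h1, unfold_lprod, hxy, bcirc_tensorProj hU, WithLp.ofLp_add, mulVec_add, ← mulVec_mulVec,
      ← mulVec_mulVec, h0, ha, mulVec_mulVec _ (bcirc U)ᵀ, transpose_bcirc_mul_bcirc hU]
    simp
  rw [frobNorm_sq_eq, h, EuclideanSpace.norm_sq_eq]
  simp [dotProduct, sq]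

end Coherence

/-! ### Least squares residuals -/

section Residual

variable {κ ι : Type*} [Fintype κ] [Fintype ι] [DecidableEq ι]

theorem mulVec_dotProduct_mulVec {κ ι : Type*} [Fintype κ] [Fintype ι] (A : Matrix κ ι ℝ)
    (v w : ι → ℝ) : (A *ᵥ v) ⬝ᵥ (A *ᵥ w) = v ⬝ᵥ ((Aᴴ * A) *ᵥ w) := by
  rw [← mulVec_mulVec, dotProduct_mulVec v, conjTranspose_eq_transpose_of_trivial, vecMul_transpose]

theorem isUnit_conjTranspose_mul_self (A : Matrix κ ι ℝ)
    (h : ∀ v, v ≠ 0 → 0 < (A *ᵥ v) ⬝ᵥ (A *ᵥ v)) : IsUnit (Aᴴ * A) := by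
  rw [← mulVec_injective_iff_isUnit]
  refine (injective_iff_map_eq_zero (Aᴴ * A).mulVecLin).2 fun v hv => ?_
  by_contra hne
  have h1 := h v hne
  rw [mulVec_dotProduct_mulVec, ← mulVecLin_apply, hv, dotProduct_zero] at h1
  exact lt_irrefl _ h1

/-- The energy of a vector after projecting out the column space of a matrix. -/
theorem exists_residual_eq (A : Matrix κ ι ℝ) (hA : IsUnit (Aᴴ * A)) (a : ι → ℝ) (z : κ → ℝ) :
    ∃ w, ‖WithLp.toLp 2 ((A *ᵥ a + z) - (A * (Aᴴ * A)⁻¹ * Aᴴ) *ᵥ (A *ᵥ a + z))‖ ^ 2 =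
        z ⬝ᵥ z - (A *ᵥ w) ⬝ᵥ (A *ᵥ w) ∧ (A *ᵥ w) ⬝ᵥ (A *ᵥ w) = (Aᴴ *ᵥ z) ⬝ᵥ w := by
  set w := (Aᴴ * A)⁻¹ *ᵥ (Aᴴ *ᵥ z) with hw
  have hdet := (isUnit_iff_isUnit_det _).1 hA
  have hGw : (Aᴴ * A) *ᵥ w = Aᴴ *ᵥ z := by
    rw [hw, mulVec_mulVec, mul_nonsing_inv _ hdet, one_mulVec]
  have hq : (A *ᵥ w) ⬝ᵥ (A *ᵥ w) = (Aᴴ *ᵥ z) ⬝ᵥ w := by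
    rw [mulVec_dotProduct_mulVec, hGw, dotProduct_comm]
  have hzw : z ⬝ᵥ (A *ᵥ w) = (Aᴴ *ᵥ z) ⬝ᵥ w := by
    rw [dotProduct_mulVec, conjTranspose_eq_transpose_of_trivial, mulVec_transpose]
  have he : (A *ᵥ a + z) - (A * (Aᴴ * A)⁻¹ * Aᴴ) *ᵥ (A *ᵥ a + z) = z - A *ᵥ w := by
    have h1 : (A * (Aᴴ * A)⁻¹ * Aᴴ) *ᵥ (A *ᵥ a) = A *ᵥ a := by
      rw [mulVec_mulVec, Matrix.mul_assoc, Matrix.mul_assoc, nonsing_inv_mul _ hdet, Matrix.mul_one]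
    have h2 : (A * (Aᴴ * A)⁻¹ * Aᴴ) *ᵥ z = A *ᵥ w := by
      rw [hw, mulVec_mulVec, mulVec_mulVec, Matrix.mul_assoc]
    rw [mulVec_add, h1, h2]
    abel
  refine ⟨w, ?_, hq⟩
  rw [he, EuclideanSpace.norm_sq_eq]
  have h3 : ∑ i, ‖(z - A *ᵥ w) i‖ ^ 2 = (z - A *ᵥ w) ⬝ᵥ (z - A *ᵥ w) := by
    simp [dotProduct, sq]
  rw [h3, sub_dotProduct, dotProduct_sub, dotProduct_sub, dotProduct_comm (A *ᵥ w) z, hzw, hq]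
  ring

theorem residual_le (A : Matrix κ ι ℝ) (hA : IsUnit (Aᴴ * A)) (a : ι → ℝ) (z : κ → ℝ) :
    ‖WithLp.toLp 2 ((A *ᵥ a + z) - (A * (Aᴴ * A)⁻¹ * Aᴴ) *ᵥ (A *ᵥ a + z))‖ ^ 2 ≤ z ⬝ᵥ z := by
  obtain ⟨w, h, -⟩ := exists_residual_eq A hA a z
  rw [h]
  have : 0 ≤ (A *ᵥ w) ⬝ᵥ (A *ᵥ w) := by simpa using dotProduct_star_self_nonneg (A *ᵥ w)
  linarith

/-- The lost energy `q = ‖A w‖²` also equals `⟨Aᴴ z, w⟩`, so Cauchy–Schwarz and `l ‖w‖² ≤ q` give `l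
q² ≤ ‖Aᴴ z‖² q`. -/
theorem le_residual (A : Matrix κ ι ℝ) (hA : IsUnit (Aᴴ * A)) (a : ι → ℝ) (z : κ → ℝ) {l : ℝ}
    (hl : 0 < l) (h : ∀ v, l * (v ⬝ᵥ v) ≤ (A *ᵥ v) ⬝ᵥ (A *ᵥ v)) :
    z ⬝ᵥ z - (Aᴴ *ᵥ z) ⬝ᵥ (Aᴴ *ᵥ z) / l ≤
      ‖WithLp.toLp 2 ((A *ᵥ a + z) - (A * (Aᴴ * A)⁻¹ * Aᴴ) *ᵥ (A *ᵥ a + z))‖ ^ 2 := by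
  obtain ⟨w, h1, h2⟩ := exists_residual_eq A hA a z
  rw [h1]
  have h3 := h w
  have h4 := dotProduct_sq_le (Aᴴ *ᵥ z) w
  rw [← h2] at h4
  set q := (A *ᵥ w) ⬝ᵥ (A *ᵥ w)
  have hq : 0 ≤ q := by simpa [q] using dotProduct_star_self_nonneg (A *ᵥ w)
  have hz : 0 ≤ (Aᴴ *ᵥ z) ⬝ᵥ (Aᴴ *ᵥ z) := by
    simpa using dotProduct_star_self_nonneg (Aᴴ *ᵥ z)
  have h5 : q ≤ (Aᴴ *ᵥ z) ⬝ᵥ (Aᴴ *ᵥ z) / l := by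
    rw [le_div_iff₀ hl]
    rcases hq.eq_or_lt with h0 | h0
    · rw [← h0]; simpa using hz
    · by_contra! hcon
      have h6 := mul_le_mul_of_nonneg_left h3 hz
      have h7 := mul_lt_mul_of_pos_right hcon h0
      have h8 := mul_le_mul_of_nonneg_left h4 hl.le
      linarith
  linarith

end Residual

/-! ### Scalar and vector tail bounds -/

section Tails

variable {X : Type*} [Fintype X] [Nonempty X] {f : X → ℝ} {M L : ℝ}

theorem expect_sub_one_sq_le (hf0 : ∀ x, 0 ≤ f x) (hfM : ∀ x, f x ≤ M) (hf1 : 𝔼 x, f x = 1) :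
    𝔼 x, (f x - 1) ^ 2 ≤ M - 1 := by
  have h (x : X) : (f x - 1) ^ 2 ≤ M * f x - 2 * f x + 1 := by
    nlinarith [mul_le_mul_of_nonneg_right (hfM x) (hf0 x)]
  refine (Finset.expect_le_expect fun x _ => h x).trans (le_of_eq ?_)
  rw [Finset.expect_add_distrib, Finset.expect_sub_distrib, ← Finset.mul_expect,
    ← Finset.mul_expect, hf1, Fintype.expect_const]
  ring

theorem one_le_of_expect_eq_one (hfM : ∀ x, f x ≤ M) (hf1 : 𝔼 x, f x = 1) : 1 ≤ M := by
  rw [← hf1]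
  exact Finset.expect_le Finset.univ_nonempty fun x _ => hfM x

theorem expect_sum_fin_eq_zero {g : X → ℝ} (hg : 𝔼 x, g x = 0) (m : ℕ) :
    𝔼 ω : Fin m → X, ∑ i, g (ω i) = 0 := by
  induction m with
  | zero => simp
  | succ m ih =>
    rw [expect_fin_succ]
    simp only [Fin.sum_univ_succ, Fin.cons_zero, Fin.cons_succ, Finset.expect_add_distrib,
      Fintype.expect_const, ih, hg, add_zero]

/-- Bernstein's inequality for sums of independent uniform samples of a centred function. -/
theorem freq_sum_ge_le {g : X → ℝ} {R v : ℝ} (hg : 𝔼 x, g x = 0) (hgR : ∀ x, g x ≤ R)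
    (hv : 𝔼 x, g x ^ 2 ≤ v) (hR : 0 < R) (hL : 0 < L) (m : ℕ) :
    freq {ω : Fin m → X | √(2 * (m * v) * L) + 2 * R * L / 3 ≤ ∑ i, g (ω i)} ≤ Real.exp (-L) := by
  have hv0 : 0 ≤ v := (Finset.expect_nonneg fun x _ => sq_nonneg (g x)).trans hv
  have hs := Real.sq_sqrt (by positivity : 0 ≤ 2 * (m * v) * L)
  set p := √(2 * (m * v) * L)
  have hp : 0 ≤ p := Real.sqrt_nonneg _
  -- For this `t` one has `t² - 2 R L t / 3 = p t ≥ p² = 2 m v L`, as Bernstein's inequality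
  -- requires.
  have h := freq_le_of_bernstein (E := ℝ) g (fun x => |g x|) (R := R) (v := v)
    (t := p + 2 * R * L / 3) (L := L) (by simpa only [sq_abs] using hv) hR (by positivity) m id
    (fun e x => by simpa using hgR x) (fun e x => by simp) (by
      have : 0 ≤ p * (2 * R * L / 3) := by positivity
      nlinarith)
  simpa [expect_sum_fin_eq_zero hg] using h

theorem freq_lt_sum_le (hf0 : ∀ x, 0 ≤ f x) (hfM : ∀ x, f x ≤ M) (hf1 : 𝔼 x, f x = 1)
    (hL : 0 < L) (m : ℕ) :
    freq {ω : Fin m → X | m + (√(2 * (m * (M - 1)) * L) + 2 * (M - 1) * L / 3) <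
      ∑ i, f (ω i)} ≤ Real.exp (-L) := by
  -- For `M = 1` the increment bound `M - 1` vanishes and Bernstein's inequality does not apply, but
  -- the sum never exceeds `m`.
  rcases (one_le_of_expect_eq_one hfM hf1).eq_or_lt with h1 | h1
  · have : {ω : Fin m → X | m + (√(2 * (m * (M - 1)) * L) + 2 * (M - 1) * L / 3) <
        ∑ i, f (ω i)} = ∅ := by
      ext ω
      have h2 : ∑ i, f (ω i) ≤ ∑ i : Fin m, M := Finset.sum_le_sum fun i _ => hfM _
      simpa [← h1] using h2
    rw [this, freq_empty]
    exact (Real.exp_pos _).le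
  · refine le_trans (freq_mono fun ω hω => ?_)
      (freq_sum_ge_le (g := fun x => f x - 1) (R := M - 1) ?_ (fun x => by linarith [hfM x])
        (expect_sub_one_sq_le hf0 hfM hf1) (by linarith) hL m)
    · simp only [Set.mem_ofPred_eq, Finset.sum_sub_distrib, Finset.sum_const, Finset.card_univ,
        Fintype.card_fin, nsmul_eq_mul, mul_one] at hω ⊢
      linarith
    · rw [Finset.expect_sub_distrib, hf1, Fintype.expect_const, sub_self]

/-- Downward increments are bounded by `1 ≤ M`, but not in general by `M - 1`. The linear term thus
exceeds that of the upper tail by `2 L / 3`, an excess that `lower_bound_le` absorbs. -/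
theorem freq_sum_lt_le (hf0 : ∀ x, 0 ≤ f x) (hfM : ∀ x, f x ≤ M) (hf1 : 𝔼 x, f x = 1)
    (hL : 0 < L) (m : ℕ) :
    freq {ω : Fin m → X | ∑ i, f (ω i) <
      m - (√(2 * (m * (M - 1)) * L) + 2 * M * L / 3)} ≤ Real.exp (-L) := by
  have hM := one_le_of_expect_eq_one hfM hf1
  refine le_trans (freq_mono fun ω hω => ?_)
    (freq_sum_ge_le (g := fun x => 1 - f x) (R := M) (v := M - 1) ?_
      (fun x => by linarith [hf0 x]) ?_ (by linarith) hL m)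
  · simp only [Set.mem_ofPred_eq, Finset.sum_sub_distrib, Finset.sum_const, Finset.card_univ,
      Fintype.card_fin, nsmul_eq_mul, mul_one] at hω ⊢
    linarith
  · rw [Finset.expect_sub_distrib, hf1, Fintype.expect_const, sub_self]
  · refine le_trans (le_of_eq ?_) (expect_sub_one_sq_le hf0 hfM hf1)
    exact Finset.expect_congr rfl fun x _ => by ring

variable {E : Type*} [NormedAddCommGroup E] [InnerProductSpace ℝ E] {z : X → E}

theorem expect_norm_add_sum_sq (hz : ∑ x, z x = 0) (m : ℕ) (e : E) :
    𝔼 ω : Fin m → X, ‖e + ∑ i, z (ω i)‖ ^ 2 = ‖e‖ ^ 2 + m * 𝔼 x, ‖z x‖ ^ 2 := by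
  induction m generalizing e with
  | zero => simp
  | succ m ih =>
    rw [expect_fin_succ]
    simp only [Fin.sum_univ_succ, Fin.cons_zero, Fin.cons_succ, ← add_assoc, ih]
    simp only [norm_add_sq_real, Finset.expect_add_distrib, Fintype.expect_const,
      ← Finset.mul_expect]
    have : 𝔼 x, inner ℝ e (z x) = 0 := by
      rw [Fintype.expect_eq_sum_div_card, ← inner_sum, hz, inner_zero_right, zero_div]
    rw [this]
    push_cast
    ring

/-- A Bernstein inequality for the norm of a sum of independent centred vectors. -/
theorem freq_norm_sum_ge_le {R v V : ℝ} (hz : ∑ x, z x = 0) (hzR : ∀ x, ‖z x‖ ≤ R) (hR : 0 < R)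
    (hv : 𝔼 x, ‖z x‖ ^ 2 ≤ v) {m : ℕ} (hV : m * v = V) (hV0 : 0 < V) (hL : 0 < L)
    (hRV : 4 / 3 * R ^ 2 * L ≤ V) :
    freq {ω : Fin m → X | √V + √(3 * V * L) ≤ ‖∑ i, z (ω i)‖} ≤ Real.exp (-L) := by
  have hs := Real.sq_sqrt hV0.le
  have hs0 := Real.sqrt_pos.2 hV0
  -- The mean norm is at most the root mean square, here through `a ≤ a² / (2 √V) + √V / 2`.
  have hmean : 𝔼 ω : Fin m → X, ‖∑ i, z (ω i)‖ ≤ √V := by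
    have h1 (ω : Fin m → X) : ‖∑ i, z (ω i)‖ ≤ ‖0 + ∑ i, z (ω i)‖ ^ 2 / (2 * √V) + √V / 2 := by
      rw [zero_add]
      have : ‖∑ i, z (ω i)‖ ^ 2 / (2 * √V) + √V / 2 - ‖∑ i, z (ω i)‖ =
          (‖∑ i, z (ω i)‖ - √V) ^ 2 / (2 * √V) := by field_simp; ring
      have h2 : 0 ≤ (‖∑ i, z (ω i)‖ - √V) ^ 2 / (2 * √V) := by positivity
      linarith
    refine (Finset.expect_le_expect fun ω _ => h1 ω).trans ?_
    rw [Finset.expect_add_distrib, ← Finset.expect_div, expect_norm_add_sum_sq hz,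
      Fintype.expect_const]
    have h3 : m * 𝔼 x, ‖z x‖ ^ 2 ≤ V := by
      rw [← hV]; gcongr
    have h4 : (‖(0 : E)‖ ^ 2 + m * 𝔼 x, ‖z x‖ ^ 2) / (2 * √V) ≤ V / (2 * √V) := by
      gcongr; simpa using h3
    have h5 : V / (2 * √V) = √V / 2 := by
      rw [div_eq_div_iff (by positivity) (by positivity)]; linarith
    linarith
  set t := √(3 * V * L) with ht
  have ht2 : t ^ 2 = 3 * V * L := Real.sq_sqrt (by positivity)
  have ht0 : 0 < t := Real.sqrt_pos.2 (by positivity)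
  -- Bernstein's condition `2 L (V + R t / 3) ≤ t² = 3 V L` is exactly this inequality; squared, it
  -- is `hRV`.
  have hRt : 2 / 3 * (R * t) ≤ V := by
    refine (sq_le_sq₀ (by positivity) hV0.le).1 ?_
    have : (2 / 3 * (R * t)) ^ 2 = V * (4 / 3 * R ^ 2 * L) := by
      rw [mul_pow, mul_pow, ht2]; ring
    rw [this, sq V]
    exact mul_le_mul_of_nonneg_left hRV hV0.le
  have h := freq_le_of_bernstein z (fun x => ‖z x‖) (R := R) (t := t) (L := L) hv hR ht0 m
    (fun e => ‖e‖) (fun e x => by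
      have := norm_add_le e (z x)
      linarith [hzR x]) (fun e x => by
      simpa using abs_norm_sub_norm_le (e + z x) e) (by
      rw [hV, ht2]
      nlinarith)
  refine le_trans (freq_mono fun ω hω => ?_) h
  simp only [Set.mem_ofPred_eq] at hω ⊢
  linarith

end Tails

/-! ### Numerical estimates behind the lower bound -/

/-- In the range where the lower bound is positive, the samples outnumber the spikes of the
residual. -/
theorem four_thirds_mul_le_of_lower_bound_pos {m L M D α β γ : ℝ} (hm : 0 < m) (hL : 0 < L)
    (hM : 1 ≤ M) (hD : 1 ≤ D) (hα : m * α = √(2 * (m * (M - 1)) * L) + 2 * (M - 1) * L / 3)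
    (hβ : β = (1 + 2 * √L) ^ 2) (hγ0 : 0 ≤ γ) (hγ : γ < 1)
    (hpos : 0 < m * (1 - α) - D * (β / (1 - γ))) : 4 / 3 * M * L ≤ m := by
  have hsL := Real.sq_sqrt hL.le
  have hs0 := Real.sqrt_nonneg L
  have hb : 4 * L ≤ β := by rw [hβ]; nlinarith
  have hML : 0 ≤ (M - 1) * L := mul_nonneg (by linarith) hL.le
  have hw : 0 ≤ 2 * (m * (M - 1)) * L := by nlinarith
  have hsw := Real.sq_sqrt hw
  have hsw0 := Real.sqrt_nonneg (2 * (m * (M - 1)) * L)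
  have hβγ : β ≤ D * (β / (1 - γ)) := by
    have h1 : β ≤ β / (1 - γ) := by
      rw [le_div_iff₀ (by linarith)]
      nlinarith
    nlinarith
  have h4 : 4 * L ≤ m := by nlinarith
  have hlt : √(2 * (m * (M - 1)) * L) ≤ m := by nlinarith
  have h5 : 2 * (m * (M - 1)) * L ≤ m ^ 2 := by rw [← hsw]; gcongr
  have h6 : 2 * ((M - 1) * L) ≤ m := by
    by_contra! hcon
    nlinarith [mul_lt_mul_of_pos_left hcon hm]
  -- Positivity gave `4 L ≤ m` (through `β`) and `2 (M - 1) L ≤ m` (through `α < 1`). Splitting `M`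
  -- as `(M - 1) + 1` bounds the left side by `2 m / 3 + m / 3`.
  linarith

/-- The vector inequality yields the constant `(1 + √(3 L))²`, which is at most `β - L`. The spare
term `D L / (1 - γ) ≥ L` covers the excess `2 L / 3` of the lower tail over `m * α`. -/
theorem lower_bound_le {m L M D N ρ s α β γ F b Res : ℝ} (hm : 0 < m) (hL : 0 < L)
    (hN : 0 < N) (hρ : 0 < ρ) (hs : 0 < s) (hDρ : D = ρ * N) (hD : 1 ≤ D)
    (hα : m * α = √(2 * (m * (M - 1)) * L) + 2 * (M - 1) * L / 3)
    (hβ : β = (1 + 2 * √L) ^ 2) (hγ0 : 0 ≤ γ) (hγ : γ < 1)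
    (hF : m - (√(2 * (m * (M - 1)) * L) + 2 * M * L / 3) ≤ F)
    (hb0 : 0 ≤ b) (hb : b ≤ √(m * (ρ * (s / N))) + √(3 * (m * (ρ * (s / N))) * L))
    (hRes : s / N * F - b ^ 2 / ((1 - γ) * (m / N)) ≤ Res) :
    (m * (1 - α) - D * (β / (1 - γ))) / N * s ≤ Res := by
  refine le_trans ?_ hRes
  set V := m * (ρ * (s / N)) with hV
  have hV0 : 0 < V := by positivity
  have h1γ : 0 < 1 - γ := by linarith
  have hsL := Real.sq_sqrt hL.le
  have hs0 := Real.sqrt_nonneg L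
  have h3L : √(3 * L) ≤ 2 * √L := by
    rw [Real.sqrt_le_left (by positivity), mul_pow, hsL]
    linarith
  have h3L2 := Real.sq_sqrt (by positivity : 0 ≤ 3 * L)
  have hbV : b ^ 2 ≤ V * (β - L) := by
    have e : √V + √(3 * V * L) = √V * (1 + √(3 * L)) := by
      rw [show 3 * V * L = V * (3 * L) by ring, Real.sqrt_mul hV0.le]; ring
    rw [e] at hb
    refine (pow_le_pow_left₀ hb0 hb 2).trans ?_
    rw [mul_pow, Real.sq_sqrt hV0.le]
    gcongr
    rw [hβ]
    nlinarith
  have h1 : b ^ 2 / ((1 - γ) * (m / N)) ≤ s / N * (D * ((β - L) / (1 - γ))) := by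
    rw [div_le_iff₀ (by positivity)]
    refine hbV.trans (le_of_eq ?_)
    rw [hV, hDρ]
    field_simp
  have h2 : L ≤ D * (L / (1 - γ)) := by
    have : L ≤ L / (1 - γ) := by
      rw [le_div_iff₀ h1γ]; nlinarith
    nlinarith
  have h3 : m * (1 - α) - D * (β / (1 - γ)) ≤ F - D * ((β - L) / (1 - γ)) := by
    rw [sub_div β]
    nlinarith
  have h4 := mul_le_mul_of_nonneg_left h3 (by positivity : 0 ≤ s / N)
  have h5 : (m * (1 - α) - D * (β / (1 - γ))) / N * s =
      s / N * (m * (1 - α) - D * (β / (1 - γ))) := by ring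
  rw [h5]
  linarith

/-! ### Sampled quantities as sums over the drawn positions -/

section Sample

variable {n₁ n₂ n₃ m : ℕ} [NeZero n₃]

theorem sampleMat_mulVec_dotProduct (U : Tensor n₁ n₂ n₃) (ω : Fin m → Fin n₁ × ZMod n₃)
    (v : Fin n₂ × ZMod n₃ → ℝ) :
    (sampleMat U ω *ᵥ v) ⬝ᵥ (sampleMat U ω *ᵥ v) = ∑ i, (bcirc U (ω i) ⬝ᵥ v) ^ 2 := by
  rw [dotProduct]
  exact Finset.sum_congr rfl fun i _ => (sq _).symm

theorem sampleVec_eq {U : Tensor n₁ n₂ n₃} {T : Tensor n₁ 1 n₃}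
    {x y : EuclideanSpace ℝ (Fin n₁ × ZMod n₃)} {a : Fin n₂ × ZMod n₃ → ℝ}
    (ha : x.ofLp = bcirc U *ᵥ a) (hxy : unfold T = x + y) (ω : Fin m → Fin n₁ × ZMod n₃) :
    sampleVec T ω = sampleMat U ω *ᵥ a + fun i => y (ω i) := by
  funext i
  simp only [sampleVec, hxy, PiLp.add_apply, ha, Pi.add_apply]
  rfl

theorem conjTranspose_sampleMat_mulVec (U : Tensor n₁ n₂ n₃) (ω : Fin m → Fin n₁ × ZMod n₃)
    (y : Fin n₁ × ZMod n₃ → ℝ) :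
    ((sampleMat U ω)ᴴ *ᵥ fun i => y (ω i)) ⬝ᵥ ((sampleMat U ω)ᴴ *ᵥ fun i => y (ω i)) =
      ‖∑ i, WithLp.toLp 2 (y (ω i) • bcirc U (ω i))‖ ^ 2 := by
  rw [EuclideanSpace.norm_sq_eq, dotProduct]
  refine Finset.sum_congr rfl fun q _ => ?_
  rw [Real.norm_eq_abs, sq_abs, ← sq]
  congr 1
  simp [mulVec, dotProduct, sampleMat, mul_comm]

theorem norm_toLp_smul_bcirc_sq (U : Tensor n₁ n₂ n₃) (p : Fin n₁ × ZMod n₃) (c : ℝ) :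
    ‖WithLp.toLp 2 (c • bcirc U p)‖ ^ 2 = c ^ 2 * (bcirc U p ⬝ᵥ bcirc U p) := by
  rw [EuclideanSpace.norm_sq_eq, dotProduct, Finset.mul_sum]
  refine Finset.sum_congr rfl fun q _ => ?_
  rw [Real.norm_eq_abs, sq_abs, ← sq]
  exact mul_pow _ _ _

theorem sum_toLp_smul_bcirc_eq_zero {U : Tensor n₁ n₂ n₃} {y : Fin n₁ × ZMod n₃ → ℝ}
    (hy : (bcirc U)ᵀ *ᵥ y = 0) : ∑ p, WithLp.toLp 2 (y p • bcirc U p) = 0 := by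
  ext q
  have := congrFun hy q
  simp only [mulVec, dotProduct, transpose_apply, Pi.zero_apply] at this
  simpa [mul_comm] using this

end Sample

/-! ### Union bound and conclusion -/

theorem ofReal_one_sub_le_of_bad_sets {Ω : Type*} [Fintype Ω] [Nonempty Ω] {δ : ℝ}
    {B₁ B₂ B₃ B₄ S : Set Ω} (h₁ : freq B₁ ≤ δ) (h₂ : freq B₂ ≤ δ) (h₃ : freq B₃ ≤ δ)
    (h₄ : freq B₄ ≤ δ) (hS : (B₁ ∪ B₂ ∪ (B₃ ∪ B₄))ᶜ ⊆ S) :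
    ENNReal.ofReal (1 - 4 * δ) ≤ (PMF.uniformOfFintype Ω).toOuterMeasure S := by
  rw [toOuterMeasure_uniformOfFintype_eq_freq]
  apply ENNReal.ofReal_le_ofReal
  have h5 := freq_add_freq_compl (B₁ ∪ B₂ ∪ (B₃ ∪ B₄))
  have h6 := freq_union_le (B₁ ∪ B₂) (B₃ ∪ B₄)
  have h7 := freq_union_le B₁ B₂
  have h8 := freq_union_le B₃ B₄
  have h9 := freq_mono hS
  linarith

theorem corollary2 {n₁ n₂ n₃ : ℕ} [NeZero n₁] [NeZero n₂] [NeZero n₃]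
    -- the columns of `U` are orthonormal and span the given subspace
    (U : Tensor n₁ n₂ n₃) (hU : lprod (ltranspose U) U = lone n₂ n₃)
    -- the signal, and the decomposition of its unfolding
    (T : Tensor n₁ 1 n₃) (x y : EuclideanSpace ℝ (Fin n₁ × ZMod n₃))
    (hx : x ∈ vecSubspace U) (hy : y ∈ (vecSubspace U)ᗮ) (hxy : unfold T = x + y)
    (δ : ℝ) (hδ : 0 < δ) (m : ℕ)
    (hm : 8 / 3 * (n₂ * n₃ * tensorCoherence U) * Real.log (2 * n₂ * n₃ / δ) ≤ (m : ℝ))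
    (α β γ : ℝ)
    (hα : α = √(2 * (n₁ * n₃ * (⨆ p, |y p|) ^ 2 - ‖y‖ ^ 2) / (m * ‖y‖ ^ 2) * Real.log (1 / δ)) +
      2 * (n₁ * n₃ * (⨆ p, |y p|) ^ 2 - ‖y‖ ^ 2) / (3 * m * ‖y‖ ^ 2) * Real.log (1 / δ))
    (hβ : β = (1 + 2 * √(Real.log (1 / δ))) ^ 2)
    (hγ : γ = √(8 * (n₂ * n₃ * tensorCoherence U) / (3 * m) * Real.log (2 * n₂ * n₃ / δ))) :
    -- `m` positions drawn independently and uniformly, with replacement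
    ENNReal.ofReal (1 - 4 * δ) ≤
      (PMF.uniformOfFintype (Fin m → Fin n₁ × ZMod n₃)).toOuterMeasure
        {ω | IsUnit ((sampleMat U ω).conjTranspose * sampleMat U ω) ∧
          (γ < 1 →
            (m * (1 - α) - n₂ * n₃ * tensorCoherence U * (β / (1 - γ))) / (n₁ * n₃) *
              frobNorm (T - lprod (tensorProj U) T) ^ 2 ≤ sampleResidual U T ω) ∧
          sampleResidual U T ω ≤
            (1 + α) * (m / (n₁ * n₃)) * frobNorm (T - lprod (tensorProj U) T) ^ 2} := by
  rcases le_or_gt (1 / 4) δ with hδ4 | hδ4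
  · rw [ENNReal.ofReal_of_nonpos (by linarith)]
    exact zero_le
  obtain ⟨ρ, hρ0, hρ, hρ1, hD⟩ := exists_row_bound hU
  obtain ⟨a, ha⟩ := exists_mulVec_of_mem_vecSubspace hx
  have hy0 := transpose_bcirc_mulVec_eq_zero hy
  have hN : (n₁ : ℝ) * n₃ = Fintype.card (Fin n₁ × ZMod n₃) := by
    simp [ZMod.card]
  have hd : (n₂ : ℝ) * n₃ = Fintype.card (Fin n₂ × ZMod n₃) := by
    simp [ZMod.card]
  have hd1 : (1 : ℝ) ≤ Fintype.card (Fin n₂ × ZMod n₃) := by exact_mod_cast Fintype.card_pos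
  have hN0 : (0 : ℝ) < Fintype.card (Fin n₁ × ZMod n₃) := by exact_mod_cast Fintype.card_pos
  rw [frobNorm_sub_tensorProj_sq hU hx hy hxy]
  rw [hN] at hα ⊢
  rw [hD] at hm hγ ⊢
  rw [mul_assoc 2 (n₂ : ℝ), hd] at hm hγ
  set d : ℝ := ((Fintype.card (Fin n₂ × ZMod n₃) : ℕ) : ℝ)
  set N : ℝ := ((Fintype.card (Fin n₁ × ZMod n₃) : ℕ) : ℝ)
  set L := Real.log (1 / δ)
  have hL : 0 < L := Real.log_pos (by rw [lt_div_iff₀ hδ]; linarith)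
  have hexpL : Real.exp (-L) = δ := by
    rw [← Real.log_inv, one_div, inv_inv, Real.exp_log hδ]
  have hLg : 0 < Real.log (2 * d / δ) := Real.log_pos (by rw [lt_div_iff₀ hδ]; linarith)
  have hexpLg : Real.exp (-Real.log (2 * d / δ)) = δ / (2 * d) := by
    rw [← Real.log_inv, inv_div, Real.exp_log (by positivity)]
  set Lg := Real.log (2 * d / δ)
  have hm0 : (0 : ℝ) < m := lt_of_lt_of_le (by positivity) hm
  have hγ2 : γ ^ 2 = 8 * (ρ * N) / (3 * m) * Lg := by
    rw [hγ, Real.sq_sqrt (by positivity)]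
  have hγ0 : 0 < γ := by rw [hγ]; exact Real.sqrt_pos.2 (by positivity)
  have hγ1 : γ ≤ 1 := by
    rw [← sq_le_one_iff₀ hγ0.le, hγ2, div_mul_eq_mul_div, div_le_one (by positivity)]
    linarith
  set B₁ : Set (Fin m → Fin n₁ × ZMod n₃) := {ω | ∃ v : Fin n₂ × ZMod n₃ → ℝ, v ≠ 0 ∧
        ∑ i, (bcirc U (ω i) ⬝ᵥ v) ^ 2 ≤ (1 - γ) * (m / N) * (v ⬝ᵥ v)} with hB₁
  have hB₁δ : freq B₁ ≤ δ := by
    refine (freq_exists_dotProduct_sum_le_exp _ (sum_vecMulVec_bcirc hU) hρ0 hρ1 hρ hγ0 m).trans ?_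
    -- The exponent `4 / 3` is more than needed: exponent `1` already beats the dimension factor
    -- `d`.
    have h1 : m * γ ^ 2 / (2 * (ρ * N)) = 4 / 3 * Lg := by
      rw [hγ2]; field_simp; norm_num
    have h2 : Real.exp (-(4 / 3 * Lg)) ≤ δ / (2 * d) := by
      rw [← hexpLg]
      exact Real.exp_le_exp.2 (by linarith)
    rw [h1]
    refine (mul_le_mul_of_nonneg_left h2 (by positivity)).trans ?_
    change d * (δ / (2 * d)) ≤ δ
    have : d * (δ / (2 * d)) = δ / 2 := by field_simp
    linarith
  have hlow {ω : Fin m → Fin n₁ × ZMod n₃} (hω : ω ∉ B₁) (v : Fin n₂ × ZMod n₃ → ℝ) (hv : v ≠ 0) :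
      (1 - γ) * (m / N) * (v ⬝ᵥ v) < (sampleMat U ω *ᵥ v) ⬝ᵥ (sampleMat U ω *ᵥ v) := by
    rw [sampleMat_mulVec_dotProduct]
    by_contra! hcon
    exact hω ⟨v, hv, hcon⟩
  -- The inequality in `hlow` is strict, so the Gram matrix is definite even in the borderline case
  -- `γ = 1`.
  have hunit {ω : Fin m → Fin n₁ × ZMod n₃} (hω : ω ∉ B₁) :
      IsUnit ((sampleMat U ω)ᴴ * sampleMat U ω) := by
    refine isUnit_conjTranspose_mul_self _ fun v hv => lt_of_le_of_lt ?_ (hlow hω v hv)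
    have h1 : 0 ≤ v ⬝ᵥ v := by simpa using dotProduct_star_self_nonneg v
    have h2 : 0 ≤ 1 - γ := by linarith
    positivity
  have hupper {ω : Fin m → Fin n₁ × ZMod n₃} (hω : ω ∉ B₁) :
      sampleResidual U T ω ≤ ∑ i, y (ω i) ^ 2 := by
    rw [sampleResidual, sampleProj, sampleVec_eq ha hxy ω]
    refine (residual_le _ (hunit hω) a _).trans (le_of_eq ?_)
    simp [dotProduct, sq]
  have hres0 (ω : Fin m → Fin n₁ × ZMod n₃) : 0 ≤ sampleResidual U T ω := sq_nonneg _
  -- For `y = 0` both bounds are multiples of `‖y‖² = 0`, so the value of `α` is immaterial and only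
  -- `B₁` has to be avoided.
  rcases eq_or_ne y 0 with rfl | hyne
  · refine ofReal_one_sub_le_of_bad_sets (B₁ := B₁) (B₂ := ∅) (B₃ := ∅) (B₄ := ∅) hB₁δ
      (freq_empty.trans_le hδ.le) (freq_empty.trans_le hδ.le) (freq_empty.trans_le hδ.le) ?_
    intro ω hω
    have hω1 : ω ∉ B₁ := by simpa using hω
    refine ⟨hunit hω1, fun _ => ?_, ?_⟩
    · simpa using hres0 ω
    · simpa using hupper hω1
  have hs : 0 < ‖y‖ ^ 2 := by positivity
  have hsum : ‖y‖ ^ 2 = ∑ p, y p ^ 2 := by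
    rw [EuclideanSpace.norm_sq_eq]; simp
  set s := ‖y‖ ^ 2
  set Y : ℝ := ⨆ p, |y p| with hY
  have hyY (p) : |y p| ≤ Y := le_ciSup (f := fun p => |y p|) (Set.finite_range _).bddAbove p
  have hyY2 (p) : y p ^ 2 ≤ Y ^ 2 := by
    rw [← sq_abs]; exact pow_le_pow_left₀ (abs_nonneg _) (hyY p) 2
  have hY0 : 0 < Y := by
    obtain ⟨p, hp⟩ : ∃ p, y p ≠ 0 := by
      by_contra! hcon
      exact hyne (by ext p; simpa using hcon p)
    exact (abs_pos.2 hp).trans_le (hyY p)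
  -- The energies are normalised to mean `1`, so that the ratio `(n₁ n₃ ‖y‖∞² - ‖y‖²) / ‖y‖²` in `α`
  -- becomes `M - 1`.
  set f : Fin n₁ × ZMod n₃ → ℝ := fun p => N * y p ^ 2 / s with hf
  set M : ℝ := N * Y ^ 2 / s with hM
  have hf0 (p) : 0 ≤ f p := by positivity
  have hfM (p) : f p ≤ M := by
    simp only [hf, hM]
    have := hyY2 p
    gcongr
  have hf1 : 𝔼 p, f p = 1 := by
    rw [Fintype.expect_eq_sum_div_card, ← Finset.sum_div, ← Finset.mul_sum, ← hsum]
    change N * s / s / N = 1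
    field_simp
  have hsf (ω : Fin m → Fin n₁ × ZMod n₃) : ∑ i, y (ω i) ^ 2 = s / N * ∑ i, f (ω i) := by
    rw [Finset.mul_sum]
    refine Finset.sum_congr rfl fun i _ => ?_
    simp only [hf]
    field_simp
  have hM1 := one_le_of_expect_eq_one hfM hf1
  have hmα : m * α = √(2 * (m * (M - 1)) * L) + 2 * (M - 1) * L / 3 := by
    have e : N * Y ^ 2 - s = s * (M - 1) := by rw [hM]; field_simp
    have e1 : 2 * (s * (M - 1)) / (m * s) * L = 2 * (m * (M - 1)) * L / (m : ℝ) ^ 2 := by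
      field_simp
    rw [hα, e, e1, Real.sqrt_div' _ (by positivity), Real.sqrt_sq hm0.le]
    field_simp
  set B₂ : Set (Fin m → Fin n₁ × ZMod n₃) := {ω | m + (√(2 * (m * (M - 1)) * L) +
    2 * (M - 1) * L / 3) < ∑ i, f (ω i)} with hB₂
  set B₃ : Set (Fin m → Fin n₁ × ZMod n₃) := {ω | ∑ i, f (ω i) <
    m - (√(2 * (m * (M - 1)) * L) + 2 * M * L / 3)} with hB₃
  set V := m * (ρ * (s / N)) with hV
  -- The first condition does not depend on `ω`: the set is empty unless the lower bound has
  -- content, and only then is the hypothesis of the vector inequality available.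
  set B₄ : Set (Fin m → Fin n₁ × ZMod n₃) :=
    {ω | (γ < 1 ∧ 0 < m * (1 - α) - ρ * N * (β / (1 - γ))) ∧
      √V + √(3 * V * L) ≤ ‖∑ i, WithLp.toLp 2 (y (ω i) • bcirc U (ω i))‖} with hB₄
  have hB₄δ : freq B₄ ≤ δ := by
    by_cases hP : γ < 1 ∧ 0 < m * (1 - α) - ρ * N * (β / (1 - γ))
    · have hspike := four_thirds_mul_le_of_lower_bound_pos hm0 hL hM1 hρ1 hmα hβ hγ0.le hP.1 hP.2
      have hz2 (p) : ‖WithLp.toLp 2 (y p • bcirc U p)‖ ^ 2 ≤ ρ * y p ^ 2 := by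
        rw [norm_toLp_smul_bcirc_sq, mul_comm]
        exact mul_le_mul_of_nonneg_right (hρ p) (sq_nonneg _)
      rw [← hexpL]
      refine le_trans (freq_mono fun ω hω => hω.2)
        (freq_norm_sum_ge_le (z := fun p => WithLp.toLp 2 (y p • bcirc U p)) (R := √ρ * Y)
          (v := ρ * (s / N)) (sum_toLp_smul_bcirc_eq_zero hy0) (fun p => ?_) (by positivity) ?_
          hV.symm (by positivity) hL ?_)
      · refine (sq_le_sq₀ (norm_nonneg _) (by positivity)).1 ((hz2 p).trans ?_)
        rw [mul_pow, Real.sq_sqrt hρ0.le]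
        exact mul_le_mul_of_nonneg_left (hyY2 p) hρ0.le
      · refine (Finset.expect_le_expect fun p _ => hz2 p).trans (le_of_eq ?_)
        rw [← Finset.mul_expect, Fintype.expect_eq_sum_div_card, ← hsum]
      · rw [mul_pow, Real.sq_sqrt hρ0.le, hV]
        have h1 : ρ * Y ^ 2 = ρ * (s / N) * M := by rw [hM]; field_simp
        rw [h1]
        have h2 := mul_le_mul_of_nonneg_left hspike (by positivity : 0 ≤ ρ * (s / N))
        linarith
    · have : B₄ = ∅ := Set.eq_empty_of_forall_notMem fun ω hω => hP hω.1
      rw [this, freq_empty]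
      exact hδ.le
  refine ofReal_one_sub_le_of_bad_sets hB₁δ (hexpL ▸ freq_lt_sum_le hf0 hfM hf1 hL m)
    (hexpL ▸ freq_sum_lt_le hf0 hfM hf1 hL m) hB₄δ (S := _) fun ω hω => ?_
  simp only [Set.mem_compl_iff, Set.mem_union, not_or] at hω
  obtain ⟨⟨hω₁, hω₂⟩, hω₃, hω₄⟩ := hω
  refine ⟨hunit hω₁, fun hγlt => ?_, ?_⟩
  · rcases le_or_gt (m * (1 - α) - ρ * N * (β / (1 - γ))) 0 with hP | hP
    · refine le_trans ?_ (hres0 ω)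
      exact mul_nonpos_of_nonpos_of_nonneg (div_nonpos_of_nonpos_of_nonneg hP hN0.le) hs.le
    have hb : ‖∑ i, WithLp.toLp 2 (y (ω i) • bcirc U (ω i))‖ ≤ √V + √(3 * V * L) := by
      by_contra! hcon
      exact hω₄ ⟨⟨hγlt, hP⟩, hcon.le⟩
    refine lower_bound_le hm0 hL hN0 hρ0 hs rfl hρ1 hmα hβ hγ0.le hγlt
      (not_lt.1 hω₃) (norm_nonneg _) hb ?_
    rw [← hsf, ← conjTranspose_sampleMat_mulVec, sampleResidual, sampleProj,
      sampleVec_eq ha hxy ω]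
    refine le_trans (le_of_eq ?_) (le_residual _ (hunit hω₁) a (fun i => y (ω i))
      (l := (1 - γ) * (m / N)) (mul_pos (by linarith) (by positivity)) fun v => ?_)
    · congr 1
      simp [dotProduct, sq]
    · rcases eq_or_ne v 0 with rfl | hv
      · simp
      · exact (hlow hω₁ v hv).le
  · refine (hupper hω₁).trans ?_
    rw [hsf]
    have h1 : ∑ i, f (ω i) ≤ m + m * α := by rw [hmα]; exact not_lt.1 hω₂
    have h2 := mul_le_mul_of_nonneg_left h1 (by positivity : 0 ≤ s / N)
    refine h2.trans (le_of_eq ?_)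
    ring
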